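/- Conventions. Alphabets are finite. $\mathrm{REG}$ and $\mathrm{CFL}$ are the families of all regular and of all context-free languages. For a family $\mathcal C$, $\mathrm{co}\,\mathcal C$ is the family of the languages $\Sigma^*\setminus A$, for $A\subseteq\Sigma^*$ in $\mathcal C$, and $\mathcal C$ is closed under complement if $A\in\mathcal C$ implies $\Sigma^*\setminus A\in\mathcal C$. A (multi-valued partial) function is a map $f:\Sigma^*\to\mathcal P(\Gamma^*)$ for alphabets $\Sigma,\Gamma$; it is single-valued if $|f(x)|\le 1$ for all $x$, and total if $f(x)\ne\emptyset$ for all $x$. $\mathrm{CFLMV}$ is the class of all functions $f$ for which there is a one-way one-head nondeterministic pushdown automaton (finite state set, finite transition function, $\lambda$-moves allowed, input $x$ given between two endmarkers, disjoint sets of accepting and rejecting halting states) with a write-only output tape, all of whose computation paths reach a halting state within $O(n)$ steps on inputs of length $n$, such that, for every $x$, $f(x)$ is the set of the strings that it outputs along its accepting computation paths on $x$. $\mathrm{NFAMV}$ is defined in the same way with one-way one-head nondeterministic finite automata with a write-only output tape ($\lambda$-moves allowed), again under the condition that all computation paths reach a halting state within $O(n)$ steps. $\mathrm{CFLSV_t}$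 and $\mathrm{NFASV_t}$ consist of the single-valued total functions in $\mathrm{CFLMV}$ and in $\mathrm{NFAMV}$, respectively. For strings $x,y$, $\left[{x\atop y}\right]$ is the two-track string whose $i$-th symbol is the pair of the $i$-th symbols of $x$ and $y$; if the lengths differ, the shorter string is first padded at its end with a new symbol $\#$ to the length of the longer one. For a language family $\mathcal C$ and a function class $\mathcal F$, $\mathcal C/\!/\mathcal F$ is the family of all languages $\{x\mid \exists y\in h(x)\ \left[{x\atop y}\right]\in B\}$ with $B\in\mathcal C$ and $h\in\mathcal F$. Proposition. (1) $\mathrm{REG}/\!/\mathrm{NFASV_t}\nsubseteq\mathrm{CFL}$ and $\mathrm{CFL}\nsubseteq\mathrm{REG}/\!/\mathrm{NFAMV}$. (2) $\mathrm{REG}/\!/\mathrm{NFASV_t}$ is closed under complement, but $\mathrm{REG}/\!/\mathrm{NFAMV}$ is not. (3) $\mathrm{CFL}\cap\mathrm{co}\,\mathrm{CFL}\subsetneqq\mathrm{REG}/\!/\mathrm{CFLSV_t}$. -/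

import Mathlib

/-! ### Language families over finite alphabets -/

/-- A family of languages: for every finite alphabet, a set of languages over that alphabet. -/
abbrev LanguageFamily : Type 1 := ∀ (α : Type) [Finite α], Set (Language α)

namespace LanguageFamily

/-- Containment of language families (over every finite alphabet). -/
def Contained (C D : LanguageFamily) : Prop :=
  ∀ (α : Type) [Finite α], C α ⊆ D α

/-- Proper containment of language families. -/
def ProperlyContained (C D : LanguageFamily) : Prop :=
  C.Contained D ∧ ¬ D.Contained C

/-- Intersection of language families. -/
def inter (C D : LanguageFamily) : LanguageFamily := fun α _ => C α ∩ D α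

/-- The family of the complements (relative to the set of all words over the alphabet) of the
languages in `C`. -/
def co (C : LanguageFamily) : LanguageFamily := fun α _ => {L | Lᶜ ∈ C α}

/-- Closure under complement. -/
def ClosedUnderCompl (C : LanguageFamily) : Prop :=
  ∀ (α : Type) [Finite α], ∀ L ∈ C α, Lᶜ ∈ C α

end LanguageFamily

/-- The family of regular languages. -/
def REG : LanguageFamily := fun _ _ => {L | L.IsRegular}

/-- The family of context-free languages. -/
def CFL : LanguageFamily := fun _ _ => {L | L.IsContextFree}

/-! ### Multi-valued partial functions -/

/-- Multi-valued partial functions from words over `α` to words over `β`; the function is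
undefined at `x` when its value there is empty. -/
abbrev MVFun (α β : Type) : Type := List α → Set (List β)

/-- A class of multi-valued partial functions between words over finite alphabets. -/
abbrev FunctionClass : Type 1 := ∀ (α β : Type) [Finite α] [Finite β], Set (MVFun α β)

namespace FunctionClass

/-- The single-valued partial functions of a class. -/
def singleValued (F : FunctionClass) : FunctionClass :=
  fun α β _ _ => {f | f ∈ F α β ∧ ∀ x, (f x).Subsingleton}

/-- The total functions of a class. -/
def total (F : FunctionClass) : FunctionClass :=
  fun α β _ _ => {f | f ∈ F α β ∧ ∀ x, (f x).Nonempty}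

end FunctionClass

/-! ### Computation paths -/

/-- `StepsTo r n c d`: there is a computation path of exactly `n` steps of `r` from `c` to `d`. -/
inductive StepsTo {C : Type} (r : C → C → Prop) : ℕ → C → C → Prop
  | zero (c : C) : StepsTo r 0 c c
  | succ {n : ℕ} {c d e : C} : StepsTo r n c d → r d e → StepsTo r (n + 1) c e

/-- The termination condition: for some linear polynomial `a * n + b`, every computation path on an
input of length `n` has at most `a * n + b` steps, and every computation path that cannot be
continued has reached a halting configuration. -/
def TerminatesInLinearTime {α C : Type} (r : C → C → Prop) (halting : C → Prop)
    (init : List α → C) : Prop :=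
  ∃ a b : ℕ, ∀ (x : List α) (n : ℕ) (c : C), StepsTo r n (init x) c →
    n ≤ a * x.length + b ∧ ((∀ d, ¬ r c d) → halting c)

/-- Input-tape symbols: the letters of the input alphabet and the two endmarkers. -/
inductive TapeSymbol (α : Type) : Type
  | leftEnd : TapeSymbol α
  | letter (a : α) : TapeSymbol α
  | rightEnd : TapeSymbol α

/-- The content of the input tape: the input between the two endmarkers. -/
def inputTape {α : Type} (x : List α) : List (TapeSymbol α) :=
  TapeSymbol.leftEnd :: (x.map TapeSymbol.letter ++ [TapeSymbol.rightEnd])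

/-! ### One-way nondeterministic pushdown automata with a write-only output tape -/

/-- A one-way one-head nondeterministic pushdown automaton with input alphabet `α`, output
alphabet `β`, inner states `Q` and stack alphabet `Θ`. In `δ q s Z`, the argument `s = none`
stands for a move that reads no input symbol (a `λ`-move), and in an element `(p, w, o)` of
`δ q s Z` the word `w` replaces the top symbol `Z` (the first letter of `w` becomes the new top)
and `o = none` means that nothing is written. -/
structure PDATransducer (α β Q Θ : Type) where
  δ : Q → Option (TapeSymbol α) → Θ → Set (Q × List Θ × Option β)
  δ_finite : ∀ q s Z, (δ q s Z).Finite
  start : Q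
  bottom : Θ
  acc : Set Q
  rej : Set Q
  disjoint : Disjoint acc rej

namespace PDATransducer

variable {α β Q Θ : Type}

/-- A configuration: inner state, unread part of the input tape, stack (top first), output. -/
structure Cfg (α β Q Θ : Type) where
  state : Q
  input : List (TapeSymbol α)
  stack : List Θ
  output : List β

/-- The initial configuration on input `x`. -/
def init (M : PDATransducer α β Q Θ) (x : List α) : Cfg α β Q Θ :=
  ⟨M.start, inputTape x, [M.bottom], []⟩

/-- One move. `s.toList` is the word of length at most one that is read from the input tape and
`o.toList` the one that is written. No move is possible in a halting state. -/
def Step (M : PDATransducer α β Q Θ) (c d : Cfg α β Q Θ) : Prop :=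
  c.state ∉ M.acc ∪ M.rej ∧
    ∃ (s : Option (TapeSymbol α)) (Z : Θ) (w v : List Θ) (o : Option β),
      (d.state, w, o) ∈ M.δ c.state s Z ∧ c.input = s.toList ++ d.input ∧
      c.stack = Z :: v ∧ d.stack = w ++ v ∧ d.output = c.output ++ o.toList

/-- The termination condition of the machine. -/
def Terminates (M : PDATransducer α β Q Θ) : Prop :=
  TerminatesInLinearTime M.Step (fun c => c.state ∈ M.acc ∪ M.rej) M.init

/-- The multi-valued partial function computed by the machine: the set of the outputs along the
accepting computation paths. -/
def function (M : PDATransducer α β Q Θ) : MVFun α β := fun x =>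
  {y | ∃ (n : ℕ) (c : Cfg α β Q Θ), StepsTo M.Step n (M.init x) c ∧ c.state ∈ M.acc ∧ c.output = y}

end PDATransducer

/-! ### One-way nondeterministic finite automata with a write-only output tape -/

/-- A one-way one-head nondeterministic finite automaton with input alphabet `α`, output alphabet
`β` and inner states `Q`; `none` stands for a `λ`-move, respectively for writing nothing. -/
structure NFATransducer (α β Q : Type) where
  δ : Q → Option (TapeSymbol α) → Set (Q × Option β)
  start : Q
  acc : Set Q
  rej : Set Q
  disjoint : Disjoint acc rej

namespace NFATransducer

variable {α β Q : Type}

/-- A configuration: inner state, unread part of the input tape, output. -/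
structure Cfg (α β Q : Type) where
  state : Q
  input : List (TapeSymbol α)
  output : List β

/-- The initial configuration on input `x`. -/
def init (M : NFATransducer α β Q) (x : List α) : Cfg α β Q :=
  ⟨M.start, inputTape x, []⟩

/-- One move; no move is possible in a halting state. -/
def Step (M : NFATransducer α β Q) (c d : Cfg α β Q) : Prop :=
  c.state ∉ M.acc ∪ M.rej ∧
    ∃ (s : Option (TapeSymbol α)) (o : Option β),
      (d.state, o) ∈ M.δ c.state s ∧ c.input = s.toList ++ d.input ∧
      d.output = c.output ++ o.toList

/-- The termination condition of the machine. -/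
def Terminates (M : NFATransducer α β Q) : Prop :=
  TerminatesInLinearTime M.Step (fun c => c.state ∈ M.acc ∪ M.rej) M.init

/-- The multi-valued partial function computed by the machine: the set of the outputs along the
accepting computation paths. -/
def function (M : NFATransducer α β Q) : MVFun α β := fun x =>
  {y | ∃ (n : ℕ) (c : Cfg α β Q), StepsTo M.Step n (M.init x) c ∧ c.state ∈ M.acc ∧ c.output = y}

end NFATransducer

/-! ### The function classes -/

/-- The functions computed by pushdown automata with an output tape under the termination
condition. -/
def CFLMV : FunctionClass := fun α β _ _ =>
  {f | ∃ (Q Θ : Type) (_ : Finite Q) (_ : Finite Θ) (M : PDATransducer α β Q Θ),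
    M.Terminates ∧ M.function = f}

/-- The single-valued total functions in `CFLMV`. -/
def CFLSVt : FunctionClass := CFLMV.singleValued.total

/-- The functions computed by finite automata with an output tape under the termination
condition. -/
def NFAMV : FunctionClass := fun α β _ _ =>
  {f | ∃ (Q : Type) (_ : Finite Q) (M : NFATransducer α β Q), M.Terminates ∧ M.function = f}

/-- The single-valued total functions in `NFAMV`. -/
def NFASVt : FunctionClass := NFAMV.singleValued.total

/-! ### The advice operator -/

/-- The two-track word with upper track `x` and lower track `y`; the shorter of the two is padded
at its end by the new symbol `none`. -/
def track {α β : Type} (x : List α) (y : List β) : List (Option α × Option β) :=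
  List.zipWithAll Prod.mk x y

/-- The family `C // F`: all languages `{x | ∃ y ∈ h x, track x y ∈ B}` with `B ∈ C`, `h ∈ F`. -/
def Advice (C : LanguageFamily) (F : FunctionClass) : LanguageFamily := fun α _ =>
  {L | ∃ (β : Type) (_ : Finite β) (B : Language (Option α × Option β)) (h : MVFun α β),
    B ∈ C (Option α × Option β) ∧ h ∈ F α β ∧ ∀ x, x ∈ L ↔ ∃ y ∈ h x, track x y ∈ B}

/-!
The word `0 ^ n * 1 ^ n * 2 ^ n` is checked by a finite automaton against the advice obtained by
erasing the letters `0` and lowering the others by one. This puts a language into `REG // NFASVt`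
that contains all these words and only words with equally many letters of each kind; it is not
context-free, since long words of a context-free language have factors of unequal lengths, missing
a common letter, that can be interchanged.

Every word of length at least two of a context-free language splits along the factors of the
right-hand sides of a grammar, so a pushdown automaton that shifts and reduces can parse it in
linear time. Parsing `L` and its complement at once and writing which of the two contains the input
gives a single-valued total function in `CFLMV` that decides `L`.

A function in `NFAMV` followed by a regular check amounts to a finite machine with two one-way heads
on the input. On a palindrome `u * v * v.reverse * u.reverse`, with `v` longer than `u`, either both
heads are in the middle part at the same time, or one of them has left the middle part before the
other one enters it. If the first case occurs for one `v` and all `u`, two words `u` give the same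
state and positions and can be exchanged after that time. Otherwise every `v` has an accepting path
on which the two heads read the middle part one after the other; two words `v` with the same `u`
then agree in the states and positions at its midpoint and its ends, so the second half of one can
be attached to the first half of the other. Both exchanges make the machine accept a non-palindrome.
Non-palindromes, however, are recognized by guessing a letter and moving it to the mirrored
position.
-/

/-! ### Regular languages and two-track words -/

theorem isRegular_of_forall_derivative {α ι : Type*} [Finite ι] (F : ι → Language α)
    (h : ∀ i a, ∃ j, ∀ w, a :: w ∈ F i ↔ w ∈ F j) (i : ι) : (F i).IsRegular := by
  choose δ hδ using h
  let M : DFA α ι := ⟨δ, i, {j | [] ∈ F j}⟩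
  have evalFrom_mem_accept (w : List α) : ∀ j, M.evalFrom j w ∈ M.accept ↔ w ∈ F j := by
    induction w with
    | nil => exact fun _ => Iff.rfl
    | cons a w ih => exact fun j => (ih (δ j a)).trans (hδ j a w).symm
  exact Language.isRegular_iff.2
    ⟨ι, Fintype.ofFinite ι, M, Set.ext fun w => evalFrom_mem_accept w i⟩

theorem isRegular_forall_mem {α : Type*} (P : α → Prop) :
    Language.IsRegular {w : List α | ∀ a ∈ w, P a} := by
  have h := isRegular_of_forall_derivative (fun b : Prop => {w : List α | b ∧ ∀ a ∈ w, P a})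
    (fun b a => ⟨b ∧ P a, fun w =>
      show (b ∧ ∀ c ∈ a :: w, P c) ↔ (b ∧ P a) ∧ ∀ c ∈ w, P c by
        rw [List.forall_mem_cons, and_assoc]⟩) True
  simpa only [true_and] using h

theorem isRegular_exists_mem {α : Type*} (P : α → Prop) :
    Language.IsRegular {w : List α | ∃ a ∈ w, P a} := by
  have h := isRegular_of_forall_derivative (fun b : Prop => {w : List α | b ∨ ∃ a ∈ w, P a})
    (fun b a => ⟨b ∨ P a, fun w =>
      show (b ∨ ∃ c ∈ a :: w, P c) ↔ (b ∨ P a) ∨ ∃ c ∈ w, P c by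
        rw [List.exists_mem_cons_iff, or_assoc]⟩) False
  simpa only [false_or] using h

@[simp]
theorem track_nil_left {α β : Type} (y : List β) :
    track ([] : List α) y = y.map fun b => (none, some b) := by
  simp [track]

@[simp]
theorem track_nil_right {α β : Type} (x : List α) :
    track x ([] : List β) = x.map fun a => (some a, none) := by
  simp [track]

@[simp]
theorem track_cons_cons {α β : Type} (a : α) (b : β) (x : List α) (y : List β) :
    track (a :: x) (b :: y) = (some a, some b) :: track x y :=
  rfl

@[simp]
theorem filterMap_fst_track {α β : Type} (x : List α) (y : List β) :
    (track x y).filterMap Prod.fst = x := by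
  induction x generalizing y with
  | nil => simp
  | cons a x ih => cases y <;> simp [ih, List.filterMap_map]

@[simp]
theorem filterMap_snd_track {α β : Type} (x : List α) (y : List β) :
    (track x y).filterMap Prod.snd = y := by
  induction x generalizing y with
  | nil => simp [List.filterMap_map]
  | cons a x ih => cases y <;> simp [ih]

theorem some_some_mem_track {α β : Type} {x : List α} {y : List β} {a : α} {b : β} :
    (some a, some b) ∈ track x y ↔ ∃ k : ℕ, x[k]? = some a ∧ y[k]? = some b := by
  rw [List.mem_iff_getElem?]
  refine exists_congr fun k => ?_
  rw [track, List.getElem?_zipWithAll]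
  cases x[k]? <;> cases y[k]? <;> simp

theorem isRegular_setOf_track_eq (α β : Type) : Language.IsRegular
    {w : List (Option α × Option β) | track (w.filterMap Prod.fst) (w.filterMap Prod.snd) = w} := by
  -- `b.2.1` and `b.2.2` tell whether letters may still occur on the upper and the lower track.
  have h := isRegular_of_forall_derivative
    (fun b : Prop × Prop × Prop => {w : List (Option α × Option β) |
      b.1 ∧ (b.2.1 ∨ w.filterMap Prod.fst = []) ∧ (b.2.2 ∨ w.filterMap Prod.snd = []) ∧
        track (w.filterMap Prod.fst) (w.filterMap Prod.snd) = w})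
    ?_ (True, True, True)
  · simpa only [true_and, true_or] using h
  rintro ⟨r, b, c⟩ p
  refine ⟨(r ∧ (b ∨ p.1 = none) ∧ (c ∨ p.2 = none) ∧ p ≠ (none, none), p.1.isSome, p.2.isSome),
    fun w => ?_⟩
  change _ ∧ _ ∧ _ ∧ _ ↔ _ ∧ _ ∧ _ ∧ _
  obtain ⟨_ | a, _ | d⟩ := p <;> simp only [List.filterMap_cons] <;>
    generalize w.filterMap Prod.fst = x <;> generalize w.filterMap Prod.snd = y <;>
    cases x <;> cases y <;> simp <;> tauto

/-! ### Context-free languages and binary families -/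

/-- `Yields g s w`: the sentential form `s` derives the word `w`, witnessed by a parse forest
instead of a sequence of rewriting steps. -/
inductive Yields {T : Type} (g : ContextFreeGrammar T) : List (Symbol T g.NT) → List T → Prop
  | nil : Yields g [] []
  | terminal (a : T) {s : List (Symbol T g.NT)} {w : List T} :
      Yields g s w → Yields g (Symbol.terminal a :: s) (a :: w)
  | nonterminal {r : ContextFreeRule T g.NT} {s : List (Symbol T g.NT)} {u v : List T} :
      r ∈ g.rules → Yields g r.output u → Yields g s v →
      Yields g (Symbol.nonterminal r.input :: s) (u ++ v)

/-- The factors of the right-hand sides of `g` and of its initial form: a finite set of sentential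
forms within which every derivation of a long word can be split in two. -/
def formFactors {T : Type} (g : ContextFreeGrammar T) : Set (List (Symbol T g.NT)) :=
  {t | t <:+: [Symbol.nonterminal g.initial] ∨ ∃ r ∈ g.rules, t <:+: r.output}

section Yields

variable {T : Type} {g : ContextFreeGrammar T}

theorem Yields.append {s t : List (Symbol T g.NT)} {u v : List T} (hs : Yields g s u)
    (ht : Yields g t v) : Yields g (s ++ t) (u ++ v) := by
  induction hs with
  | nil => exact ht
  | terminal a _ ih => exact ih.terminal a
  | nonterminal hr h _ _ ih => simpa using Yields.nonterminal hr h ih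

theorem Yields.exists_of_append {s t : List (Symbol T g.NT)} {w : List T}
    (h : Yields g (s ++ t) w) : ∃ u v, w = u ++ v ∧ Yields g s u ∧ Yields g t v := by
  induction s generalizing w with
  | nil => exact ⟨[], w, rfl, .nil, h⟩
  | cons X s ih =>
    rw [List.cons_append] at h
    cases h with
    | terminal a h =>
      obtain ⟨u, v, rfl, hu, hv⟩ := ih h
      exact ⟨a :: u, v, rfl, hu.terminal a, hv⟩
    | nonterminal hr h₁ h =>
      obtain ⟨u, v, rfl, hu, hv⟩ := ih h
      exact ⟨_, v, (List.append_assoc _ _ _).symm, .nonterminal hr h₁ hu, hv⟩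

theorem yields_map_terminal (w : List T) : Yields g (w.map Symbol.terminal) w := by
  induction w with
  | nil => exact .nil
  | cons a w ih => exact ih.terminal a

theorem Yields.of_rewrites {r : ContextFreeRule T g.NT} (hr : r ∈ g.rules)
    {s t : List (Symbol T g.NT)} (h : r.Rewrites s t) {w : List T} (ht : Yields g t w) :
    Yields g s w := by
  induction h generalizing w with
  | head s =>
    obtain ⟨u, v, rfl, hu, hv⟩ := ht.exists_of_append
    exact .nonterminal hr hu hv
  | cons X _ ih =>
    cases ht with
    | terminal a h => exact (ih h).terminal a
    | nonterminal hr' h₁ h => exact .nonterminal hr' h₁ (ih h)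

theorem derives_map_terminal_iff_yields {s : List (Symbol T g.NT)} {w : List T} :
    g.Derives s (w.map Symbol.terminal) ↔ Yields g s w := by
  constructor
  · intro h
    induction h using Relation.ReflTransGen.head_induction_on with
    | refl => exact yields_map_terminal w
    | head h _ ih =>
      obtain ⟨r, hr, h⟩ := h
      exact ih.of_rewrites hr h
  · intro h
    induction h with
    | nil => exact ContextFreeGrammar.Derives.refl _
    | terminal a _ ih => exact ih.append_left [Symbol.terminal a]
    | @nonterminal r s u v hr _ _ ih₁ ih₂ =>
      have h₁ : g.Produces (Symbol.nonterminal r.input :: s) (r.output ++ s) :=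
        ⟨r, hr, .head s⟩
      rw [List.map_append]
      exact h₁.trans_derives ((ih₁.append_right s).trans (ih₂.append_left _))

theorem finite_formFactors (g : ContextFreeGrammar T) : (formFactors g).Finite := by
  have finite_infixes (f : List (Symbol T g.NT)) : {t | t <:+: f}.Finite :=
    (List.finite_toSet f.sublists).subset fun t ht => List.mem_sublists.2 ht.sublist
  have h : formFactors g = {t | t <:+: [Symbol.nonterminal g.initial]} ∪
      ⋃ r ∈ (g.rules : Set (ContextFreeRule T g.NT)), {t | t <:+: r.output} := by
    ext t
    simp [formFactors]
  rw [h]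
  exact (finite_infixes _).union (g.rules.finite_toSet.biUnion fun r _ => finite_infixes _)

theorem mem_formFactors_of_isInfix {s t : List (Symbol T g.NT)} (h : s ∈ formFactors g)
    (hts : t <:+: s) : t ∈ formFactors g :=
  h.imp hts.trans fun ⟨r, hr, h⟩ => ⟨r, hr, hts.trans h⟩

theorem Yields.exists_split {s : List (Symbol T g.NT)} {w : List T} (h : Yields g s w)
    (hs : s ∈ formFactors g) (hw : 2 ≤ w.length) :
    ∃ u v, ∃ s₁ ∈ formFactors g, ∃ s₂ ∈ formFactors g, w = u ++ v ∧ u ≠ [] ∧ v ≠ [] ∧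
      Yields g s₁ u ∧ Yields g s₂ v ∧
      ∀ u' v', Yields g s₁ u' → Yields g s₂ v' → Yields g s (u' ++ v') := by
  induction h with
  | nil => simp at hw
  | @terminal a s w h _ =>
    have hw₀ : w ≠ [] := by
      rintro rfl
      simp at hw
    exact ⟨[a], w, [Symbol.terminal a], mem_formFactors_of_isInfix hs ⟨[], s, by simp⟩, s,
      mem_formFactors_of_isInfix hs ⟨[Symbol.terminal a], [], by simp⟩, rfl, by simp, hw₀,
      yields_map_terminal [a], h, fun u' v' h₁ h₂ => h₁.append h₂⟩
  | @nonterminal r s u v hr hu hv ihu ihv =>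
    have hs' : s ∈ formFactors g :=
      mem_formFactors_of_isInfix hs ⟨[Symbol.nonterminal r.input], [], by simp⟩
    rcases eq_or_ne u [] with rfl | hu₀
    · obtain ⟨u₁, v₁, s₁, h₁, s₂, h₂, e, n₁, n₂, y₁, y₂, y⟩ := ihv hs' hw
      exact ⟨u₁, v₁, s₁, h₁, s₂, h₂, e, n₁, n₂, y₁, y₂,
        fun u' v' h₁ h₂ => by simpa using Yields.nonterminal hr hu (y u' v' h₁ h₂)⟩
    rcases eq_or_ne v [] with rfl | hv₀
    · rw [List.append_nil] at hw ⊢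
      obtain ⟨u₁, v₁, s₁, h₁, s₂, h₂, e, n₁, n₂, y₁, y₂, y⟩ :=
        ihu (Or.inr ⟨r, hr, List.infix_rfl⟩) hw
      exact ⟨u₁, v₁, s₁, h₁, s₂, h₂, e, n₁, n₂, y₁, y₂,
        fun u' v' h₁ h₂ => by simpa using Yields.nonterminal hr (y u' v' h₁ h₂) hv⟩
    · have hu' : Yields g [Symbol.nonterminal r.input] u := by
        simpa using Yields.nonterminal hr hu .nil
      exact ⟨u, v, [Symbol.nonterminal r.input], mem_formFactors_of_isInfix hs ⟨[], s, by simp⟩,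
        s, hs', rfl, hu₀, hv₀, hu', hv, fun u' v' h₁ h₂ => h₁.append h₂⟩

end Yields

/-- A family of languages in which every word with at least two letters splits into nonempty words
of two members whose product is contained in the member considered. For a finite family this is
what remains of a Chomsky normal form when the names of the nonterminals are forgotten. -/
def IsBinaryFamily {α N : Type*} (F : N → Language α) : Prop :=
  ∀ n, ∀ w ∈ F n, 2 ≤ w.length → ∃ u v n₁ n₂, w = u ++ v ∧ u ≠ [] ∧ v ≠ [] ∧
    u ∈ F n₁ ∧ v ∈ F n₂ ∧ F n₁ * F n₂ ≤ F n

theorem exists_isBinaryFamily_of_isContextFree {α : Type} {L : Language α}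
    (h : L.IsContextFree) :
    ∃ (N : Type) (_ : Finite N) (F : N → Language α) (s : N), F s = L ∧ IsBinaryFamily F := by
  obtain ⟨g, rfl⟩ := h
  refine ⟨formFactors g, finite_formFactors g, fun s => {w | Yields g s w},
    ⟨[Symbol.nonterminal g.initial], Or.inl List.infix_rfl⟩,
    Set.ext fun w => derives_map_terminal_iff_yields.symm, ?_⟩
  rintro ⟨s, hs⟩ w hw hl
  obtain ⟨u, v, s₁, h₁, s₂, h₂, e, n₁, n₂, y₁, y₂, y⟩ := Yields.exists_split hw hs hl
  refine ⟨u, v, ⟨s₁, h₁⟩, ⟨s₂, h₂⟩, e, n₁, n₂, y₁, y₂, ?_⟩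
  rintro _ ⟨u', hu', v', hv', rfl⟩
  exact y u' v' hu' hv'

theorem IsBinaryFamily.sigma {α ι : Type*} {N : ι → Type*} {F : ∀ i, N i → Language α}
    (h : ∀ i, IsBinaryFamily (F i)) : IsBinaryFamily fun n : Sigma N => F n.1 n.2 := by
  rintro ⟨i, n⟩ w hw hl
  obtain ⟨u, v, n₁, n₂, H⟩ := h i n w hw hl
  exact ⟨u, v, ⟨i, n₁⟩, ⟨i, n₂⟩, H⟩

theorem exists_isBinaryFamily_of_forall_isContextFree {α ι : Type} [Finite ι]
    {K : ι → Language α} (h : ∀ i, (K i).IsContextFree) :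
    ∃ (N : Type) (_ : Finite N) (F : N → Language α) (s : ι → N),
      (∀ i, F (s i) = K i) ∧ IsBinaryFamily F := by
  choose N hN F s hs hF using fun i => exists_isBinaryFamily_of_isContextFree (h i)
  exact ⟨Sigma N, inferInstance, fun n => F n.1 n.2, fun i => ⟨i, s i⟩, hs, .sigma hF⟩

theorem IsBinaryFamily.exists_factor {α N : Type*} {F : N → Language α} (h : IsBinaryFamily F)
    {k : ℕ} (hk : 0 < k) (n : N) (w : List α) (hw : w ∈ F n) (hl : k ≤ w.length) :
    ∃ (x u y : List α) (m : N), w = x ++ u ++ y ∧ k ≤ u.length ∧ u.length < 2 * k ∧ u ∈ F m ∧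
      ∀ u' ∈ F m, x ++ u' ++ y ∈ F n := by
  induction hN : w.length using Nat.strong_induction_on generalizing n w with
  | _ N ih =>
    rcases lt_or_ge w.length (2 * k) with hlt | hge
    · exact ⟨[], w, [], n, by simp, hl, hlt, hw, fun u' hu' => by simpa using hu'⟩
    obtain ⟨u, v, n₁, n₂, rfl, hu, hv, hu', hv', hle⟩ := h n w hw (by omega)
    have hu₀ := List.length_pos_iff.2 hu
    have hv₀ := List.length_pos_iff.2 hv
    rw [List.length_append] at hN hge
    rcases le_or_gt k u.length with hku | hku
    · obtain ⟨x, t, y, m, rfl, h₁, h₂, h₃, h₄⟩ := ih u.length (by omega) n₁ u hu' hku rfl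
      refine ⟨x, t, y ++ v, m, by simp, h₁, h₂, h₃, fun t' ht' => ?_⟩
      have H : x ++ t' ++ y ++ v ∈ F n := hle (Language.append_mem_mul (h₄ t' ht') hv')
      simpa using H
    · obtain ⟨x, t, y, m, rfl, h₁, h₂, h₃, h₄⟩ :=
        ih v.length (by omega) n₂ v hv' (by omega) rfl
      refine ⟨u ++ x, t, y, m, by simp, h₁, h₂, h₃, fun t' ht' => ?_⟩
      have H : u ++ (x ++ t' ++ y) ∈ F n := hle (Language.append_mem_mul hu' (h₄ t' ht'))
      simpa using H

theorem exists_interchange_of_isContextFree {α κ : Type} [Finite κ] {L : Language α}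
    (hL : L.IsContextFree) {w : ℕ → List α} (hw : ∀ n, w n ∈ L) (hlen : ∀ n, n ≤ (w n).length)
    {P : κ → List α → Prop} (hP : ∀ n u, u <:+: w n → u.length ≤ n → ∃ k, P k u) :
    ∃ k u u' x y, P k u ∧ P k u' ∧ u.length < u'.length ∧ x ++ u ++ y ∈ L ∧
      x ++ u' ++ y ∈ L := by
  obtain ⟨N, _, F, s, rfl, hF⟩ := exists_isBinaryFamily_of_isContextFree hL
  have exists_factor (i : ℕ) := hF.exists_factor (k := 3 ^ i) (by positivity) s
    (w (2 * 3 ^ i)) (hw _) (by have := hlen (2 * 3 ^ i); omega)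
  choose x u y m w_eq le_length length_lt mem_m exchange using exists_factor
  choose k hk using fun i => hP _ (u i) ⟨x i, y i, (w_eq i).symm⟩ (length_lt i).le
  obtain ⟨i, j, hij, e⟩ := Finite.exists_ne_map_eq_of_infinite fun i => (m i, k i)
  wlog hlt : i < j generalizing i j
  · exact this j i hij.symm e.symm (by omega)
  obtain ⟨hm, hk'⟩ := Prod.mk.inj e
  have length_lt_length : (u i).length < (u j).length := calc
    _ < 2 * 3 ^ i := length_lt i
    _ ≤ 3 ^ (i + 1) := by omega
    _ ≤ 3 ^ j := Nat.pow_le_pow_right (by norm_num) hlt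
    _ ≤ _ := le_length j
  exact ⟨k i, u i, u j, x i, y i, hk i, hk' ▸ hk j, length_lt_length,
    exchange i _ (mem_m i), exchange i _ (hm ▸ mem_m j)⟩

/-- The word `0 ^ n * 1 ^ n * 2 ^ n`. -/
def threeBlocks (n : ℕ) : List (Fin 3) :=
  List.replicate n 0 ++ List.replicate n 1 ++ List.replicate n 2

theorem exists_notMem_of_infix_threeBlocks {n : ℕ} {u : List (Fin 3)} (h : u <:+: threeBlocks n)
    (hu : u.length ≤ n) : ∃ a, a ∉ u := by
  obtain ⟨x, y, h⟩ := h
  by_contra! all_mem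
  obtain ⟨i, hi, hi₀⟩ := List.mem_iff_getElem.1 (all_mem 0)
  obtain ⟨j, hj, hj₂⟩ := List.mem_iff_getElem.1 (all_mem 2)
  have position (k : ℕ) (hk : k < u.length) : (threeBlocks n)[x.length + k]? = some u[k] := by
    rw [← h, List.append_assoc, List.getElem?_append_right (by omega), Nat.add_sub_cancel_left,
      List.getElem?_append_left hk, List.getElem?_eq_getElem hk]
  have hi' := position i hi
  have hj' := position j hj
  rw [hi₀, threeBlocks] at hi'
  rw [hj₂, threeBlocks] at hj'
  grind

theorem not_isContextFree_of_length_eq_three_mul_count {L : Language (Fin 3)}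
    (hL : ∀ n, threeBlocks n ∈ L) (hcount : ∀ w ∈ L, ∀ a, w.length = 3 * w.count a) :
    ¬ L.IsContextFree := by
  intro h
  obtain ⟨a, u, u', x, y, ha, ha', hlt, hu, hu'⟩ := exists_interchange_of_isContextFree h hL
    (fun n => by simp only [threeBlocks, List.length_append, List.length_replicate]; omega)
    (P := fun a u => a ∉ u) fun n u => exists_notMem_of_infix_threeBlocks
  have e := hcount _ hu a
  have e' := hcount _ hu' a
  simp only [List.count_append, List.length_append, List.count_eq_zero.2 ha,
    List.count_eq_zero.2 ha'] at e e'
  omega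

/-! ### Computation paths -/

namespace StepsTo

variable {C D : Type} {r : C → C → Prop}

theorem exists_iff_reflTransGen {c d : C} :
    (∃ n, StepsTo r n c d) ↔ Relation.ReflTransGen r c d := by
  constructor
  · rintro ⟨n, h⟩
    induction h with
    | zero => exact .refl
    | succ _ h ih => exact ih.tail h
  · intro h
    induction h with
    | refl => exact ⟨0, .zero _⟩
    | tail _ h ih =>
      obtain ⟨n, hn⟩ := ih
      exact ⟨n + 1, hn.succ h⟩

theorem invariant {P : C → Prop} (h : ∀ c d, P c → r c d → P d) {n : ℕ} {c d : C}
    (hcd : StepsTo r n c d) (hc : P c) : P d := by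
  induction hcd with
  | zero => exact hc
  | succ _ hr ih => exact h _ _ (ih hc) hr

theorem add_le {μ : C → ℕ} (h : ∀ c d, r c d → μ d < μ c) {n : ℕ} {c d : C}
    (hcd : StepsTo r n c d) : n + μ d ≤ μ c := by
  induction hcd with
  | zero => simp
  | succ _ hr ih =>
    have := h _ _ hr
    omega

theorem map_iff {r' : D → D → Prop} {f : C → D}
    (h : ∀ c d', r' (f c) d' ↔ ∃ d, r c d ∧ d' = f d) {n : ℕ} {c : C} {d' : D} :
    StepsTo r' n (f c) d' ↔ ∃ d, StepsTo r n c d ∧ d' = f d := by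
  constructor
  · intro hn
    generalize e : f c = c' at hn
    induction hn with
    | zero => exact ⟨c, .zero c, e.symm⟩
    | succ _ hs ih =>
      obtain ⟨d, hd, rfl⟩ := ih e
      obtain ⟨d', hd', rfl⟩ := (h _ _).1 hs
      exact ⟨d', hd.succ hd', rfl⟩
  · rintro ⟨d, hn, rfl⟩
    induction hn with
    | zero => exact .zero _
    | succ _ hs ih => exact ih.succ ((h _ _).2 ⟨_, hs, rfl⟩)

end StepsTo

theorem terminatesInLinearTime_of_measure {α C : Type} {r : C → C → Prop} {halting : C → Prop}
    {init : List α → C} {μ : C → ℕ} (hμ : ∀ c d, r c d → μ d < μ c) {a b : ℕ}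
    (hinit : ∀ x, μ (init x) ≤ a * x.length + b)
    (hstep : ∀ x n c, StepsTo r n (init x) c → ¬ halting c → ∃ d, r c d) :
    TerminatesInLinearTime r halting init := by
  refine ⟨a, b, fun x n c h => ⟨?_, fun hc => ?_⟩⟩
  · have h₁ := h.add_le hμ
    have h₂ := hinit x
    omega
  · by_contra hc'
    obtain ⟨d, hd⟩ := hstep x n c h hc'
    exact hc d hd

theorem length_inputTape {α : Type} (x : List α) : (inputTape x).length = x.length + 2 := by
  simp [inputTape]

/-! ### Finite transducers -/

namespace NFATransducer

variable {α β Q : Type}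

/-- `M.Emits q t y`: started in the state `q` with unread tape `t`, some accepting path of `M`
writes `y`. -/
inductive Emits (M : NFATransducer α β Q) : Q → List (TapeSymbol α) → List β → Prop
  | halt {q : Q} (t : List (TapeSymbol α)) : q ∈ M.acc → Emits M q t []
  | step {q p : Q} {s : Option (TapeSymbol α)} {o : Option β} {t : List (TapeSymbol α)}
      {y : List β} : q ∉ M.acc ∪ M.rej → (p, o) ∈ M.δ q s → Emits M p t y →
      Emits M q (s.toList ++ t) (o.toList ++ y)

section Emits

variable {M : NFATransducer α β Q}

theorem Emits.exists_run {q : Q} {t : List (TapeSymbol α)} {y : List β} (h : M.Emits q t y)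
    (z : List β) : ∃ c, Relation.ReflTransGen M.Step ⟨q, t, z⟩ c ∧ c.state ∈ M.acc ∧
      c.output = z ++ y := by
  induction h generalizing z with
  | halt t h => exact ⟨_, .refl, h, by simp⟩
  | @step q p s o t y hq hδ _ ih =>
    obtain ⟨c, hc, ha, ho⟩ := ih (z ++ o.toList)
    exact ⟨c, .head ⟨hq, s, o, hδ, rfl, rfl⟩ hc, ha, by simp [ho]⟩

theorem exists_emits_of_run {c d : Cfg α β Q} (h : Relation.ReflTransGen M.Step c d)
    (ha : d.state ∈ M.acc) : ∃ y, M.Emits c.state c.input y ∧ d.output = c.output ++ y := by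
  induction h using Relation.ReflTransGen.head_induction_on with
  | refl => exact ⟨[], .halt _ ha, by simp⟩
  | head hs _ ih =>
    obtain ⟨y, hy, e⟩ := ih
    obtain ⟨hq, s, o, hδ, hi, ho⟩ := hs
    exact ⟨o.toList ++ y, hi ▸ .step hq hδ hy, by rw [e, ho, List.append_assoc]⟩

theorem mem_function_iff_emits {x : List α} {y : List β} :
    y ∈ M.function x ↔ M.Emits M.start (inputTape x) y := by
  constructor
  · rintro ⟨n, c, h, ha, rfl⟩
    obtain ⟨y, hy, e⟩ := exists_emits_of_run (StepsTo.exists_iff_reflTransGen.1 ⟨n, h⟩) ha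
    exact (show c.output = y from e) ▸ hy
  · intro h
    obtain ⟨c, hc, ha, ho⟩ := h.exists_run []
    obtain ⟨n, hn⟩ := StepsTo.exists_iff_reflTransGen.2 hc
    exact ⟨n, c, hn, ha, ho⟩

theorem emits_iff_of_mem_acc {q : Q} (h : q ∈ M.acc) {t : List (TapeSymbol α)} {y : List β} :
    M.Emits q t y ↔ y = [] := by
  constructor
  · rintro (⟨_, _⟩ | ⟨hq, _, _⟩)
    · rfl
    · exact (hq (Or.inl h)).elim
  · rintro rfl
    exact .halt _ h

theorem not_emits_of_mem_rej {q : Q} (h : q ∈ M.rej) {t : List (TapeSymbol α)} {y : List β} :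
    ¬ M.Emits q t y := by
  rintro (⟨_, ha⟩ | ⟨hq, _, _⟩)
  · exact Set.disjoint_left.1 M.disjoint ha h
  · exact hq (Or.inr h)

theorem emits_cons_iff {q : Q} (hq : q ∉ M.acc ∪ M.rej)
    (hlambda : ∀ p o, (p, o) ∈ M.δ q none → p ∈ M.rej) {a : TapeSymbol α}
    {t : List (TapeSymbol α)} {y : List β} :
    M.Emits q (a :: t) y ↔ ∃ p o z, (p, o) ∈ M.δ q (some a) ∧ M.Emits p t z ∧
      y = o.toList ++ z := by
  constructor
  · intro h
    generalize e : a :: t = t' at h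
    cases h with
    | halt _ ha => exact (hq (Or.inl ha)).elim
    | @step _ p s o t' z _ hδ h =>
      rcases s with _ | b
      · exact (not_emits_of_mem_rej (hlambda p o hδ) h).elim
      · obtain ⟨rfl, rfl⟩ := List.cons.inj e
        exact ⟨p, o, z, hδ, h, rfl⟩
  · rintro ⟨p, o, z, hδ, h, rfl⟩
    exact .step (s := some a) hq hδ h

end Emits

section RealTime

/-- The outputs of a finite transducer that moves by `δ` on each letter and may write an element of
`fin q` when the input ends in the state `q`. -/
def realTimeOutput (δ : Q → α → Set (Q × Option β)) (fin : Q → Set (Option β)) :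
    Q → List α → Set (List β)
  | q, [] => {y | ∃ o ∈ fin q, y = o.toList}
  | q, a :: x => {y | ∃ p o z, (p, o) ∈ δ q a ∧ z ∈ realTimeOutput δ fin p x ∧ y = o.toList ++ z}

/-- The machine computing `realTimeOutput δ fin start`. The states `inr true` and `inr false` are
halting, and the latter can be entered at any time, so that no path gets stuck. -/
def realTime (δ : Q → α → Set (Q × Option β)) (fin : Q → Set (Option β)) (start : Q) :
    NFATransducer α β (Q ⊕ Bool) where
  δ q s := match q, s with
    | _, none => {(.inr false, none)}
    | .inl q, some .leftEnd => {(.inl q, none)}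
    | .inl q, some (.letter a) => (fun p : Q × Option β => (.inl p.1, p.2)) '' δ q a
    | .inl q, some .rightEnd => (fun o => (.inr true, o)) '' fin q
    | .inr _, some _ => ∅
  start := .inl start
  acc := {.inr true}
  rej := {.inr false}
  disjoint := by simp

variable {δ : Q → α → Set (Q × Option β)} {fin : Q → Set (Option β)} {start : Q}

theorem realTime_terminates : (realTime δ fin start).Terminates := by
  refine terminatesInLinearTime_of_measure (a := 1) (b := 3)
    (μ := fun c => c.input.length + c.state.elim (fun _ => 1) fun _ => 0) ?_ ?_ ?_
  · rintro ⟨q | b, t, y⟩ ⟨p, t', y'⟩ ⟨hq, s, o, hδ, hi, -⟩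
    · rcases s with _ | _ | _ | _ <;> rcases p with p | p <;> simp_all [realTime]
    · cases b <;> simp [realTime] at hq
  · intro x
    simp [init, realTime, length_inputTape]
  · rintro x n ⟨q | b, t, y⟩ - hc
    · exact ⟨⟨.inr false, t, y⟩, hc, none, none, rfl, rfl, by simp⟩
    · cases b <;> simp [realTime] at hc

theorem realTime_emits_inl_cons_iff {q : Q} {a : TapeSymbol α} {t : List (TapeSymbol α)}
    {y : List β} : (realTime δ fin start).Emits (.inl q) (a :: t) y ↔
      ∃ p o z, (p, o) ∈ (realTime δ fin start).δ (.inl q) (some a) ∧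
        (realTime δ fin start).Emits p t z ∧ y = o.toList ++ z :=
  emits_cons_iff (by simp [realTime]) fun p o h => by
    exact congrArg Prod.fst (show (p, o) = (.inr false, none) from h)

theorem realTime_emits_inl_iff {q : Q} {x : List α} {y : List β} :
    (realTime δ fin start).Emits (.inl q) (x.map .letter ++ [.rightEnd]) y ↔
      y ∈ realTimeOutput δ fin q x := by
  induction x generalizing q y with
  | nil =>
    have hacc : Sum.inr true ∈ (realTime δ fin start).acc := rfl
    rw [List.map_nil, List.nil_append, realTime_emits_inl_cons_iff]
    constructor
    · rintro ⟨_, o, z, ⟨_, ho, ⟨⟩⟩, hz, rfl⟩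
      exact ⟨o, ho, by rw [(emits_iff_of_mem_acc hacc).1 hz, List.append_nil]⟩
    · rintro ⟨o, ho, rfl⟩
      exact ⟨_, o, [], ⟨o, ho, rfl⟩, .halt _ hacc, (List.append_nil _).symm⟩
  | cons a x ih =>
    rw [List.map_cons, List.cons_append, realTime_emits_inl_cons_iff]
    constructor
    · rintro ⟨_, _, z, ⟨⟨p, o⟩, hp, ⟨⟩⟩, hz, rfl⟩
      exact ⟨p, o, z, hp, ih.1 hz, rfl⟩
    · rintro ⟨p, o, z, hp, hz, rfl⟩
      exact ⟨.inl p, o, z, ⟨(p, o), hp, rfl⟩, ih.2 hz, rfl⟩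

theorem realTime_function : (realTime δ fin start).function = realTimeOutput δ fin start := by
  funext x
  ext y
  rw [mem_function_iff_emits, inputTape]
  refine realTime_emits_inl_cons_iff.trans ?_
  constructor
  · rintro ⟨_, _, z, ⟨⟩, hz, rfl⟩
    exact realTime_emits_inl_iff.1 hz
  · exact fun hy => ⟨_, none, y, rfl, realTime_emits_inl_iff.2 hy, rfl⟩

end RealTime

/-- A finite transducer as a pushdown transducer with a constant stack. -/
def toPDA [Finite β] [Finite Q] (M : NFATransducer α β Q) : PDATransducer α β Q Unit where
  δ q s _ := (fun p : Q × Option β => (p.1, [()], p.2)) '' M.δ q s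
  δ_finite _ _ _ := (Set.toFinite _).image _
  start := M.start
  bottom := ()
  acc := M.acc
  rej := M.rej
  disjoint := M.disjoint

/-- The configuration of `M.toPDA` that corresponds to a configuration of `M`. -/
def Cfg.toPDA (c : Cfg α β Q) : PDATransducer.Cfg α β Q Unit := ⟨c.state, c.input, [()], c.output⟩

section ToPDA

variable [Finite β] [Finite Q] {M : NFATransducer α β Q}

theorem toPDA_step_iff (c : Cfg α β Q) (d : PDATransducer.Cfg α β Q Unit) :
    M.toPDA.Step c.toPDA d ↔ ∃ d', M.Step c d' ∧ d = d'.toPDA := by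
  constructor
  · obtain ⟨q, t, k, y⟩ := d
    rintro ⟨hq, s, Z, w, v, o, ⟨p, hδ, ⟨⟩⟩, hi, ⟨⟩, rfl, ho⟩
    exact ⟨⟨p.1, t, y⟩, ⟨hq, s, p.2, hδ, hi, ho⟩, rfl⟩
  · rintro ⟨d', ⟨hq, s, o, hδ, hi, ho⟩, rfl⟩
    exact ⟨hq, s, (), [()], [], o, ⟨_, hδ, rfl⟩, hi, rfl, rfl, ho⟩

theorem toPDA_stepsTo_init_iff {n : ℕ} {x : List α} {d : PDATransducer.Cfg α β Q Unit} :
    StepsTo M.toPDA.Step n (M.toPDA.init x) d ↔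
      ∃ d', StepsTo M.Step n (M.init x) d' ∧ d = d'.toPDA :=
  StepsTo.map_iff (c := M.init x) toPDA_step_iff

theorem toPDA_function : M.toPDA.function = M.function := by
  funext x
  ext y
  constructor
  · rintro ⟨n, c, h, ha, rfl⟩
    obtain ⟨d, hd, rfl⟩ := toPDA_stepsTo_init_iff.1 h
    exact ⟨n, d, hd, ha, rfl⟩
  · rintro ⟨n, c, h, ha, rfl⟩
    exact ⟨n, c.toPDA, toPDA_stepsTo_init_iff.2 ⟨c, h, rfl⟩, ha, rfl⟩

theorem Terminates.toPDA (h : M.Terminates) : M.toPDA.Terminates := by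
  obtain ⟨a, b, h⟩ := h
  refine ⟨a, b, fun x n c hc => ?_⟩
  obtain ⟨d, hd, rfl⟩ := toPDA_stepsTo_init_iff.1 hc
  exact ⟨(h x n d hd).1, fun hs => (h x n d hd).2
    fun e he => hs e.toPDA ((toPDA_step_iff d _).2 ⟨e, he, rfl⟩)⟩

end ToPDA

end NFATransducer

theorem NFAMV_subset_CFLMV (α β : Type) [Finite α] [Finite β] : NFAMV α β ⊆ CFLMV α β := by
  rintro _ ⟨Q, _, M, hM, rfl⟩
  exact ⟨Q, Unit, inferInstance, inferInstance, M.toPDA, hM.toPDA, M.toPDA_function⟩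

theorem NFASVt_subset_CFLSVt (α β : Type) [Finite α] [Finite β] : NFASVt α β ⊆ CFLSVt α β :=
  fun _ hf => ⟨⟨NFAMV_subset_CFLMV α β hf.1.1, hf.1.2⟩, hf.2⟩

theorem realTimeOutput_mem_NFAMV {α β Q : Type} [Finite α] [Finite β] [Finite Q]
    (δ : Q → α → Set (Q × Option β)) (fin : Q → Set (Option β)) (start : Q) :
    NFATransducer.realTimeOutput δ fin start ∈ NFAMV α β :=
  ⟨Q ⊕ Bool, inferInstance, NFATransducer.realTime δ fin start,
    NFATransducer.realTime_terminates, NFATransducer.realTime_function⟩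

theorem filterMap_mem_NFASVt {α β : Type} [Finite α] [Finite β] (f : α → Option β) :
    (fun x => {x.filterMap f}) ∈ NFASVt α β := by
  have h := realTimeOutput_mem_NFAMV (fun (_ : Unit) a => {((), f a)}) (fun _ => {none}) ()
  have output_eq : NFATransducer.realTimeOutput (fun (_ : Unit) a => {((), f a)})
      (fun _ => {none}) () = fun x => {x.filterMap f} := by
    funext x
    induction x with
    | nil => simp [NFATransducer.realTimeOutput]
    | cons a x ih => cases e : f a <;> simp [NFATransducer.realTimeOutput, ih, e]
  rw [output_eq] at h
  exact ⟨⟨h, fun x => Set.subsingleton_singleton⟩, fun x => Set.singleton_nonempty _⟩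

theorem getElem?_reverse_cons_eq_some_iff {α : Type*} {a b : α} {x : List α} {k : ℕ} :
    (a :: x).reverse[k]? = some b ↔ x.reverse[k]? = some b ∨ k = x.length ∧ a = b := by
  rw [List.reverse_cons, List.getElem?_append, List.length_reverse]
  split_ifs with h
  · simp [h.ne]
  · rw [List.getElem?_singleton]
    grind

theorem delayedLetter_mem_NFAMV (α : Type) [Finite α] :
    (fun x : List α => {y | ∃ k b, x.reverse[k]? = some b ∧
      y = List.replicate k none ++ [some b]}) ∈ NFAMV α (Option α) := by
  -- Guess a letter `b` of the input, write a blank for each later letter and `b` at the end.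
  let δ : Option α → α → Set (Option α × Option (Option α)) := fun q a =>
    q.elim {(none, none), (some a, none)} fun b => {(some b, some none)}
  let fin : Option α → Set (Option (Option α)) := fun q => q.elim ∅ fun b => {some (some b)}
  have output_some (b : α) (x : List α) : NFATransducer.realTimeOutput δ fin (some b) x =
      {List.replicate x.length none ++ [some b]} := by
    induction x with
    | nil => simp [NFATransducer.realTimeOutput, fin]
    | cons a x ih => simp [NFATransducer.realTimeOutput, δ, ih, List.replicate_succ]
  have output_none (x : List α) : NFATransducer.realTimeOutput δ fin none x =
      {y | ∃ k b, x.reverse[k]? = some b ∧ y = List.replicate k none ++ [some b]} := by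
    induction x with
    | nil => simp [NFATransducer.realTimeOutput, fin]
    | cons a x ih =>
      ext y
      constructor
      · rintro ⟨p, o, z, ⟨⟨⟩⟩ | ⟨⟨⟩⟩, hz, rfl⟩
        · obtain ⟨k, b, hk, rfl⟩ := ih ▸ hz
          exact ⟨k, b, getElem?_reverse_cons_eq_some_iff.2 (.inl hk), rfl⟩
        · exact ⟨x.length, a, getElem?_reverse_cons_eq_some_iff.2 (.inr ⟨rfl, rfl⟩),
            by rwa [output_some] at hz⟩
      · rintro ⟨k, b, hk, rfl⟩
        rcases getElem?_reverse_cons_eq_some_iff.1 hk with hk | ⟨rfl, rfl⟩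
        · exact ⟨none, none, _, .inl rfl, ih ▸ ⟨k, b, hk, rfl⟩, rfl⟩
        · exact ⟨some a, none, _, .inr rfl, output_some a x ▸ rfl, rfl⟩
  exact (funext output_none : NFATransducer.realTimeOutput δ fin none = _) ▸
    realTimeOutput_mem_NFAMV δ fin none

/-! ### Advice from finite transducers -/

theorem Advice.mono {C : LanguageFamily} {F G : FunctionClass}
    (h : ∀ (α β : Type) [Finite α] [Finite β], F α β ⊆ G α β) :
    (Advice C F).Contained (Advice C G) := by
  rintro α _ L ⟨β, _, B, f, hB, hf, hL⟩
  exact ⟨β, inferInstance, B, f, hB, h _ _ hf, hL⟩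

theorem Advice.closedUnderCompl {C : LanguageFamily} (hC : C.ClosedUnderCompl)
    (F : FunctionClass) : (Advice C F.singleValued.total).ClosedUnderCompl := by
  rintro α _ L ⟨β, _, B, h, hB, hh, hL⟩
  refine ⟨β, inferInstance, Bᶜ, h, hC _ B hB, hh, fun x => ?_⟩
  obtain ⟨y, hy⟩ := hh.2 x
  have exists_mem_iff (B : Language (Option α × Option β)) :
      (∃ z ∈ h x, track x z ∈ B) ↔ track x y ∈ B :=
    ⟨fun ⟨z, hz, hzB⟩ => hh.1.2 x hz hy ▸ hzB, fun hyB => ⟨y, hy, hyB⟩⟩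
  rw [exists_mem_iff]
  exact ((hL x).trans (exists_mem_iff B)).not

theorem closedUnderCompl_advice_NFASVt : (Advice REG NFASVt).ClosedUnderCompl :=
  Advice.closedUnderCompl (fun _ _ _ => Language.IsRegular.compl) NFAMV

/-- The partial predecessor on three letters. Erasing the zeros of `0 ^ n * 1 ^ n * 2 ^ n` and
applying it to the rest leaves the prefix `0 ^ n * 1 ^ n`. -/
def lowerLetter : Fin 3 → Option (Fin 3) := ![none, some 0, some 1]

/-- The words that agree with their image under `lowerLetter` as far as it reaches, and continue
with letters `2` only. -/
def shiftedBlocks : Language (Fin 3) :=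
  {x | ∀ p ∈ track x (x.filterMap lowerLetter), p.1 = some (p.2.getD 2)}

theorem shiftedBlocks_mem_advice : shiftedBlocks ∈ Advice REG NFASVt (Fin 3) :=
  ⟨Fin 3, inferInstance, {w | ∀ p ∈ w, p.1 = some (p.2.getD 2)},
    fun x => {x.filterMap lowerLetter}, isRegular_forall_mem _, filterMap_mem_NFASVt lowerLetter,
    fun x => by simp only [Set.mem_singleton_iff, exists_eq_left]; rfl⟩

theorem track_append_self {α : Type} (y z : List α) : track (y ++ z) y =
    y.map (fun a => (some a, some a)) ++ z.map fun a => (some a, none) := by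
  induction y with
  | nil => simp
  | cons a y ih => simp [ih]

theorem threeBlocks_mem_shiftedBlocks (n : ℕ) : threeBlocks n ∈ shiftedBlocks := by
  have h : (threeBlocks n).filterMap lowerLetter = List.replicate n 0 ++ List.replicate n 1 := by
    simp only [threeBlocks, List.filterMap_append]
    rw [List.filterMap_replicate_of_none rfl,
      List.filterMap_replicate_of_some (f := lowerLetter) (b := 0) rfl,
      List.filterMap_replicate_of_some (f := lowerLetter) (b := 1) rfl, List.nil_append]
  intro p hp
  rw [h, threeBlocks, track_append_self, List.mem_append, List.mem_map, List.mem_map] at hp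
  rcases hp with ⟨a, -, rfl⟩ | ⟨a, ha, rfl⟩
  · rfl
  · rw [List.eq_of_mem_replicate ha]
    rfl

theorem count_eq_count_of_forall_mem_track {α β : Type} [DecidableEq α] [DecidableEq β]
    {x : List α} {y : List β} {a : α} {b : β}
    (h : ∀ p ∈ track x y, p.1 = some a ↔ p.2 = some b) : x.count a = y.count b := by
  calc x.count a = ((track x y).filterMap Prod.fst).count a := by rw [filterMap_fst_track]
    _ = (track x y).countP fun p => p.1 == some a := List.count_filterMap
    _ = (track x y).countP fun p => p.2 == some b :=
      List.countP_congr fun p hp => by simpa only [beq_iff_eq] using h p hp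
    _ = ((track x y).filterMap Prod.snd).count b := List.count_filterMap.symm
    _ = y.count b := by rw [filterMap_snd_track]

theorem length_eq_three_mul_count_of_mem_shiftedBlocks {x : List (Fin 3)}
    (hx : x ∈ shiftedBlocks) (a : Fin 3) : x.length = 3 * x.count a := by
  have count_eq (b : Fin 3) (hb : b ≠ 2) : x.count b = (x.filterMap lowerLetter).count b :=
    count_eq_count_of_forall_mem_track fun p hp => by
      rw [hx p hp]
      rcases p.2 with _ | c <;> simp [hb.symm]
  have count_lowered (b c : Fin 3) (h : ∀ d, lowerLetter d = some b ↔ d = c) :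
      (x.filterMap lowerLetter).count b = x.count c := by
    rw [List.count_filterMap]
    exact List.countP_congr fun d _ => by simpa using h d
  have h₀ := (count_eq 0 (by decide)).trans (count_lowered 0 1 (by decide))
  have h₁ := (count_eq 1 (by decide)).trans (count_lowered 1 2 (by decide))
  have length_eq : x.length = x.count 0 + x.count 1 + x.count 2 := by
    simpa [Fin.sum_univ_three] using
      (Multiset.sum_count_eq_card (s := Finset.univ) (m := (x : Multiset (Fin 3))) (by simp)).symm
  fin_cases a <;> simp only [Fin.zero_eta, Fin.mk_one, Fin.reduceFinMk] <;> omega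

theorem not_isContextFree_shiftedBlocks : ¬ shiftedBlocks.IsContextFree :=
  not_isContextFree_of_length_eq_three_mul_count threeBlocks_mem_shiftedBlocks
    fun _ => length_eq_three_mul_count_of_mem_shiftedBlocks

theorem not_advice_NFASVt_contained_CFL : ¬ (Advice REG NFASVt).Contained CFL := fun h =>
  not_isContextFree_shiftedBlocks (h (Fin 3) shiftedBlocks_mem_advice)

theorem not_advice_CFLSVt_contained_inter : ¬ (Advice REG CFLSVt).Contained (CFL.inter CFL.co) :=
  fun h => not_isContextFree_shiftedBlocks
    (h (Fin 3) (Advice.mono NFASVt_subset_CFLSVt (Fin 3) shiftedBlocks_mem_advice)).1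

/-! ### A shift-reduce transducer -/

/-- The moves of a bottom-up parser for the members of `F`, which writes `i` if it recognizes its
input as a word of `K i`. In the state `inl c` it is running and holds the top of the stack of
parsed symbols in `c`, so that two symbols are visible to a reduction; the rest of that stack lies
above the bottom symbol `none`. The states `inr true` and `inr false` are halting. -/
inductive ShiftReduceMove {α ι N : Type} (F : N → Language α) (K : ι → Language α) :
    Option N ⊕ Bool → Option (TapeSymbol α) → Option N →
      (Option N ⊕ Bool) × List (Option N) × Option ι → Prop
  | reject (q : Option N ⊕ Bool) (Z : Option N) :
      ShiftReduceMove F K q none Z (.inr false, [Z], none)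
  | start (Z : Option N) :
      ShiftReduceMove F K (.inl none) (some .leftEnd) Z (.inl none, [Z], none)
  | shift {a : α} {n : N} (c Z : Option N) : [a] ∈ F n →
      ShiftReduceMove F K (.inl c) (some (.letter a)) Z
        (.inl (some n), c.toList.map some ++ [Z], none)
  | reduce {n₁ n₂ n : N} : F n₁ * F n₂ ≤ F n →
      ShiftReduceMove F K (.inl (some n₂)) none (some n₁) (.inl (some n), [], none)
  | accept {c : Option N} {i : ι} : c.elim 1 F ≤ K i →
      ShiftReduceMove F K (.inl c) (some .rightEnd) none (.inr true, [none], some i)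

/-- The pushdown transducer with the moves `ShiftReduceMove F K`. -/
def shiftReduce {α ι N : Type} [Finite ι] [Finite N] (F : N → Language α) (K : ι → Language α) :
    PDATransducer α ι (Option N ⊕ Bool) (Option N) where
  δ q s Z := {r | ShiftReduceMove F K q s Z r}
  δ_finite q s Z := by
    refine (Set.finite_univ.prod ((List.finite_length_le (Option N) 2).prod
      Set.finite_univ)).subset fun r hr => ⟨trivial, ?_, trivial⟩
    rcases hr with _ | _ | ⟨_ | _⟩ | _ | _ <;> simp
  start := .inl none
  bottom := none
  acc := {.inr true}
  rej := {.inr false}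
  disjoint := by simp

/-- The words parsed into the stack `ns` of symbols, the top symbol being the last factor. -/
def stackLanguage {α N : Type} (F : N → Language α) : List N → Language α
  | [] => 1
  | n :: ns => stackLanguage F ns * F n

/-- The configuration of a running shift-reduce transducer with parsed symbols `ns`. -/
def parsingCfg {α ι N : Type} (ns : List N) (t : List (TapeSymbol α)) :
    PDATransducer.Cfg α ι (Option N ⊕ Bool) (Option N) :=
  ⟨.inl ns.head?, t, ns.tail.map some ++ [none], []⟩

/-- The configurations that a shift-reduce transducer can reach on input `x`. -/
inductive ShiftReduceInvariant {α ι N : Type} (F : N → Language α) (K : ι → Language α)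
    (x : List α) : PDATransducer.Cfg α ι (Option N ⊕ Bool) (Option N) → Prop
  | init : ShiftReduceInvariant F K x (parsingCfg [] (inputTape x))
  | running {u v : List α} (ns : List N) : x = u ++ v → u ∈ stackLanguage F ns →
      ShiftReduceInvariant F K x (parsingCfg ns (v.map .letter ++ [.rightEnd]))
  | accepted {i : ι} (t : List (TapeSymbol α)) (st : List (Option N)) : x ∈ K i →
      ShiftReduceInvariant F K x ⟨.inr true, t, st, [i]⟩
  | rejected (t : List (TapeSymbol α)) (st : List (Option N)) (y : List ι) :
      ShiftReduceInvariant F K x ⟨.inr false, t, st, y⟩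

section ShiftReduce

variable {α ι N : Type} [Finite ι] [Finite N] {F : N → Language α} {K : ι → Language α}

theorem ShiftReduceInvariant.step_init {x : List α}
    {d : PDATransducer.Cfg α ι (Option N ⊕ Bool) (Option N)}
    (h : (shiftReduce F K).Step (parsingCfg [] (inputTape x)) d) :
    ShiftReduceInvariant F K x d := by
  rcases d with ⟨q, t, st, y⟩
  obtain ⟨-, s, Z, w, v, o, hδ | _ | _ | _ | _, hi, ⟨⟩, rfl, rfl⟩ := h
  · exact .rejected _ _ _
  · cases hi
    exact .running (u := []) [] rfl rfl
  all_goals cases hi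

theorem ShiftReduceInvariant.step_parsing {x u v : List α} {ns : List N} (hx : x = u ++ v)
    (hu : u ∈ stackLanguage F ns) {d : PDATransducer.Cfg α ι (Option N ⊕ Bool) (Option N)}
    (h : (shiftReduce F K).Step (parsingCfg ns (v.map .letter ++ [.rightEnd])) d) :
    ShiftReduceInvariant F K x d := by
  rcases d with ⟨q, t, st, y⟩
  obtain ⟨-, s, Z, w, r, o, hδ, hi, hs, rfl, rfl⟩ := h
  change ShiftReduceMove F K (.inl ns.head?) s Z (q, w, o) at hδ
  change v.map .letter ++ [.rightEnd] = s.toList ++ t at hi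
  change ns.tail.map some ++ [none] = Z :: r at hs
  generalize hc : (Sum.inl ns.head? : Option N ⊕ Bool) = p at hδ
  rcases hδ with _ | _ | @⟨a, n, c, _, ha⟩ | @⟨n₁, n₂, n, hle⟩ | @⟨c, i, hle⟩
  · exact .rejected _ _ _
  · rcases v with _ | ⟨b, v⟩ <;> cases hi
  · rcases v with _ | ⟨b, v⟩ <;> cases hi
    have stack_eq : c.toList.map some ++ [Z] ++ r = ns.map some ++ [none] := by
      rw [List.append_assoc, List.singleton_append, ← hs, ← Sum.inl.inj hc]
      cases ns <;> rfl
    rw [stack_eq]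
    exact .running (n :: ns) (hx.trans (List.append_cons u a v))
      (Language.append_mem_mul hu ha)
  · cases hi
    obtain _ | ⟨_, _ | ⟨_, ns⟩⟩ := ns <;> cases hc <;> cases hs
    obtain ⟨_, ⟨u₀, hu₀, u₁, hu₁, rfl⟩, u₂, hu₂, rfl⟩ := hu
    exact .running (n :: ns) hx
      ⟨u₀, hu₀, u₁ ++ u₂, hle ⟨u₁, hu₁, u₂, hu₂, rfl⟩, (List.append_assoc _ _ _).symm⟩
  · rcases v with _ | ⟨b, v⟩ <;> cases hi
    rw [List.append_nil] at hx
    refine .accepted _ _ (hx ▸ hle ?_)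
    obtain _ | ⟨n, _ | ⟨_, ns⟩⟩ := ns <;> cases hc <;> cases hs
    · exact hu
    · exact (one_mul (F n)).le hu

theorem ShiftReduceInvariant.step {x : List α}
    {c d : PDATransducer.Cfg α ι (Option N ⊕ Bool) (Option N)}
    (hc : ShiftReduceInvariant F K x c) (h : (shiftReduce F K).Step c d) :
    ShiftReduceInvariant F K x d := by
  cases hc with
  | init => exact step_init h
  | running ns hx hu => exact step_parsing hx hu h
  | accepted => exact (h.1 (.inl rfl)).elim
  | rejected => exact (h.1 (.inr rfl)).elim

theorem shiftReduceInvariant_of_stepsTo {x : List α} {n : ℕ}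
    {c : PDATransducer.Cfg α ι (Option N ⊕ Bool) (Option N)}
    (h : StepsTo (shiftReduce F K).Step n ((shiftReduce F K).init x) c) :
    ShiftReduceInvariant F K x c :=
  h.invariant (fun _ _ hc hs => hc.step hs) .init

theorem shiftReduce_terminates : (shiftReduce F K).Terminates := by
  refine terminatesInLinearTime_of_measure (a := 2) (b := 6) (μ := fun c =>
    2 * c.input.length + c.stack.length + c.state.elim (fun _ => 1) fun _ => 0) ?_ ?_ ?_
  · rintro ⟨q, t, st, y⟩ ⟨q', t', st', y'⟩ ⟨hq, s, Z, w, v, o, hδ, rfl, rfl, rfl, -⟩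
    rcases hδ with _ | _ | ⟨_ | _⟩ | _ | _
    · rcases q with _ | _ | _
      · simp
      · exact (hq (.inr rfl)).elim
      · exact (hq (.inl rfl)).elim
    all_goals simp <;> omega
  · intro x
    simp only [PDATransducer.init, shiftReduce, length_inputTape, List.length_singleton,
      Sum.elim_inl]
    omega
  · intro x n c h hc
    have exists_step {ns : List N} {t : List (TapeSymbol α)} :
        ∃ d, (shiftReduce F K).Step (parsingCfg ns t) d := by
      obtain ⟨Z, v, hv⟩ := List.exists_cons_of_ne_nil
        (show ns.tail.map some ++ [none] ≠ [] by simp)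
      exact ⟨⟨.inr false, t, Z :: v, []⟩, by simp [parsingCfg, shiftReduce], none, Z, [Z], v, none,
        .reject _ _, rfl, hv, rfl, rfl⟩
    cases shiftReduceInvariant_of_stepsTo h with
    | init => exact exists_step
    | running => exact exists_step
    | accepted => exact (hc (.inl rfl)).elim
    | rejected => exact (hc (.inr rfl)).elim

theorem shiftReduce_parses (hF : IsBinaryFamily F) {n : N} {w : List α} (hw : w ∈ F n)
    (hw₀ : w ≠ []) (t : List (TapeSymbol α)) (ns : List N) :
    Relation.ReflTransGen (shiftReduce F K).Step (parsingCfg ns (w.map .letter ++ t))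
      (parsingCfg (n :: ns) t) := by
  have running (c : Option N) : Sum.inl c ∉ (shiftReduce F K).acc ∪ (shiftReduce F K).rej := by
    simp [shiftReduce]
  induction hl : w.length using Nat.strong_induction_on generalizing n w t ns with
  | _ l ih =>
    have h₀ := List.length_pos_iff.2 hw₀
    rcases Nat.lt_or_ge w.length 2 with h₁ | h₂
    · obtain ⟨a, rfl⟩ := List.length_eq_one_iff.1 (show w.length = 1 by omega)
      obtain ⟨Z, v, hv⟩ := List.exists_cons_of_ne_nil
        (show ns.tail.map some ++ [none] ≠ [] by simp)
      refine .single ⟨running _, some (.letter a), Z, _, v, none, .shift _ Z hw, rfl, hv, ?_, rfl⟩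
      rw [List.append_assoc, List.singleton_append, ← hv]
      cases ns <;> rfl
    · obtain ⟨u, v, n₁, n₂, rfl, hu₀, hv₀, hu, hv, hle⟩ := hF n w hw h₂
      have hu₁ := List.length_pos_iff.2 hu₀
      have hv₁ := List.length_pos_iff.2 hv₀
      rw [List.length_append] at hl
      have parse_u := ih u.length (by omega) hu hu₀ (v.map .letter ++ t) ns rfl
      have parse_v := ih v.length (by omega) hv hv₀ t (n₁ :: ns) rfl
      rw [List.map_append, List.append_assoc]
      exact (parse_u.trans parse_v).tail
        ⟨running _, none, some n₁, [], ns.map some ++ [none], none, .reduce hle, rfl, rfl, rfl, rfl⟩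

theorem mem_shiftReduce_function_iff (hF : IsBinaryFamily F) {s : ι → N} (hs : ∀ i, F (s i) = K i)
    {x : List α} {y : List ι} :
    y ∈ (shiftReduce F K).function x ↔ ∃ i, x ∈ K i ∧ y = [i] := by
  constructor
  · rintro ⟨n, c, h, ha, rfl⟩
    cases shiftReduceInvariant_of_stepsTo h with
    | accepted _ _ hx => exact ⟨_, hx, rfl⟩
    | _ => cases ha
  · rintro ⟨i, hx, rfl⟩
    have running (c : Option N) : Sum.inl c ∉ (shiftReduce F K).acc ∪ (shiftReduce F K).rej := by
      simp [shiftReduce]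
    have start : (shiftReduce F K).Step ((shiftReduce F K).init x)
        (parsingCfg [] (x.map .letter ++ [.rightEnd])) :=
      ⟨running _, some .leftEnd, none, [none], [], none, .start _, rfl, rfl, rfl, rfl⟩
    have accept {c : Option N} (hc : c.elim 1 F ≤ K i) :
        (shiftReduce F K).Step (parsingCfg c.toList [.rightEnd]) ⟨.inr true, [], [none], [i]⟩ :=
      ⟨running _, some .rightEnd, none, [none], [], some i, .accept (by cases c <;> exact hc), rfl,
        by cases c <;> rfl, rfl, rfl⟩
    have run : Relation.ReflTransGen (shiftReduce F K).Step
        (parsingCfg [] (x.map .letter ++ [.rightEnd])) ⟨.inr true, [], [none], [i]⟩ := by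
      rcases eq_or_ne x [] with rfl | hx₀
      · exact .single (accept (c := none) (by rintro _ rfl; exact hx))
      · exact (shiftReduce_parses hF (hs i ▸ hx : x ∈ F (s i)) hx₀ _ _).tail
          (accept (c := some (s i)) (hs i).le)
    obtain ⟨n, hn⟩ := StepsTo.exists_iff_reflTransGen.2 (run.head start)
    exact ⟨n, _, hn, rfl, rfl⟩

end ShiftReduce

theorem setOf_mem_mem_CFLMV {α ι : Type} [Finite α] [Finite ι] {K : ι → Language α}
    (hK : ∀ i, (K i).IsContextFree) : (fun x => {y | ∃ i, x ∈ K i ∧ y = [i]}) ∈ CFLMV α ι := by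
  obtain ⟨N, _, F, s, hs, hF⟩ := exists_isBinaryFamily_of_forall_isContextFree hK
  exact ⟨_, _, inferInstance, inferInstance, shiftReduce F K, shiftReduce_terminates,
    funext fun x => Set.ext fun y => mem_shiftReduce_function_iff hF hs⟩

theorem inter_co_contained_advice_CFLSVt : (CFL.inter CFL.co).Contained (Advice REG CFLSVt) := by
  classical
  rintro α _ L ⟨hL, hL'⟩
  let h : MVFun α Bool := fun x => {[decide (x ∈ L)]}
  have h_mem : h ∈ CFLMV α Bool := by
    have hK : ∀ b, (bif b then L else Lᶜ).IsContextFree := Bool.forall_bool.2 ⟨hL', hL⟩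
    convert setOf_mem_mem_CFLMV hK using 1
    ext x y
    have mem_iff (b : Bool) : x ∈ (bif b then L else Lᶜ) ↔ decide (x ∈ L) = b := by
      cases b
      · exact decide_eq_false_iff_not.symm
      · exact decide_eq_true_iff.symm
    simp only [mem_iff, exists_eq_left']
    rfl
  refine ⟨Bool, inferInstance, {w | ∃ p ∈ w, p.2 = some true}, h, isRegular_exists_mem _,
    ⟨⟨h_mem, fun x => Set.subsingleton_singleton⟩, fun x => Set.singleton_nonempty _⟩, fun x => ?_⟩
  calc x ∈ L ↔ true ∈ [decide (x ∈ L)] := by simp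
    _ ↔ true ∈ (track x [decide (x ∈ L)]).filterMap Prod.snd := by rw [filterMap_snd_track]
    _ ↔ ∃ p ∈ track x [decide (x ∈ L)], p.2 = some true := List.mem_filterMap
    _ ↔ _ := by
      simp only [h, Set.mem_singleton_iff, exists_eq_left]
      rfl

/-! ### Palindromes -/

/-- The words obtained from a sentential form by replacing each nonterminal `n` by a word of
`J n`. -/
def formLanguage {T N : Type} (J : N → Language T) : List (Symbol T N) → Language T
  | [] => 1
  | .terminal a :: s => {[a]} * formLanguage J s
  | .nonterminal n :: s => J n * formLanguage J s

theorem Yields.mem_formLanguage {T : Type} {g : ContextFreeGrammar T} {J : g.NT → Language T}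
    (hJ : ∀ r ∈ g.rules, formLanguage J r.output ≤ J r.input) {s : List (Symbol T g.NT)}
    {w : List T} (h : Yields g s w) : w ∈ formLanguage J s := by
  induction h with
  | nil => rfl
  | terminal a _ ih => exact Language.append_mem_mul (a := [a]) rfl ih
  | nonterminal hr _ _ ih₁ ih₂ => exact Language.append_mem_mul (hJ _ hr ih₁) ih₂

/-- The palindromes over the alphabet `α`. -/
def palindromes (α : Type) : Language α := {w | w.Palindrome}

/-- The grammar with the rules `S → λ`, `S → a` and `S → a S a`. -/
noncomputable def palindromeGrammar (α : Type) [Finite α] : ContextFreeGrammar α where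
  NT := Unit
  initial := ()
  rules := (Set.toFinite ({⟨(), []⟩} ∪ ((Set.range fun a => ⟨(), [.terminal a]⟩) ∪
    Set.range fun a => ⟨(), [.terminal a, .nonterminal (), .terminal a]⟩))).toFinset

section Palindromes

variable {α : Type}

theorem mem_palindromeGrammar_rules [Finite α] {r : ContextFreeRule α Unit} :
    r ∈ (palindromeGrammar α).rules ↔ r = ⟨(), []⟩ ∨ (∃ a, ⟨(), [.terminal a]⟩ = r) ∨
      ∃ a, ⟨(), [.terminal a, .nonterminal (), .terminal a]⟩ = r :=
  Set.Finite.mem_toFinset _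

theorem palindrome_of_yields [Finite α] {w : List α}
    (h : Yields (palindromeGrammar α) [.nonterminal ()] w) : w.Palindrome := by
  have h' := h.mem_formLanguage (J := fun _ => palindromes α) fun r hr => by
    rcases mem_palindromeGrammar_rules.1 hr with rfl | ⟨a, rfl⟩ | ⟨a, rfl⟩
    · rintro _ rfl
      exact .nil
    · rintro _ ⟨_, rfl, _, rfl, rfl⟩
      exact .singleton a
    · rintro _ ⟨_, rfl, _, ⟨v, hv, _, ⟨_, rfl, _, rfl, rfl⟩, rfl⟩, rfl⟩
      exact .cons_concat a hv
  obtain ⟨v, hv, _, rfl, rfl⟩ := h'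
  simpa using (show v.Palindrome from hv)

theorem yields_of_palindrome [Finite α] {w : List α} (h : w.Palindrome) :
    Yields (palindromeGrammar α) [.nonterminal ()] w := by
  have of_rule {r : ContextFreeRule α Unit} (hr : r ∈ (palindromeGrammar α).rules) {w : List α}
      (hw : Yields (palindromeGrammar α) r.output w) :
      Yields (palindromeGrammar α) [.nonterminal ()] w := by
    simpa using Yields.nonterminal hr hw .nil
  induction h with
  | nil => exact of_rule (mem_palindromeGrammar_rules.2 (.inl rfl)) .nil
  | singleton a =>
    exact of_rule (mem_palindromeGrammar_rules.2 (.inr (.inl ⟨a, rfl⟩))) (.terminal a .nil)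
  | cons_concat a _ ih =>
    exact of_rule (mem_palindromeGrammar_rules.2 (.inr (.inr ⟨a, rfl⟩)))
      (.terminal a (ih.append (.terminal a .nil)))

theorem isContextFree_palindromes [Finite α] : (palindromes α).IsContextFree :=
  ⟨palindromeGrammar α, Set.ext fun _ => derives_map_terminal_iff_yields.trans
    ⟨palindrome_of_yields, yields_of_palindrome⟩⟩

theorem not_palindrome_iff {x : List α} : ¬ x.Palindrome ↔
    ∃ (k : ℕ) (a b : α), x[k]? = some a ∧ x.reverse[k]? = some b ∧ a ≠ b := by
  rw [List.Palindrome.iff_reverse_eq]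
  constructor
  · intro h
    obtain ⟨k, hk⟩ : ∃ k : ℕ, x[k]? ≠ x.reverse[k]? := by
      by_contra! hx
      exact h (List.ext_getElem? hx).symm
    have hlt : k < x.length := by
      by_contra! hle
      rw [List.getElem?_eq_none hle, List.getElem?_eq_none (by simpa using hle)] at hk
      exact hk rfl
    have ha := List.getElem?_eq_getElem hlt
    have hb := List.getElem?_eq_getElem (show k < x.reverse.length by simpa using hlt)
    exact ⟨k, _, _, ha, hb, fun hab => hk (by rw [ha, hb, hab])⟩
  · rintro ⟨k, a, b, ha, hb, hab⟩ h
    rw [h, ha] at hb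
    exact hab (Option.some.inj hb)

theorem compl_palindromes_mem_advice [Finite α] : (palindromes α)ᶜ ∈ Advice REG NFAMV α := by
  refine ⟨Option α, inferInstance,
    {w | ∃ p ∈ w, ∃ a b, a ≠ b ∧ p = (some a, some (some b))}, _, isRegular_exists_mem _,
    delayedLetter_mem_NFAMV α, fun x => not_palindrome_iff.trans ?_⟩
  constructor
  · rintro ⟨k, a, b, ha, hb, hab⟩
    exact ⟨_, ⟨k, b, hb, rfl⟩, _, some_some_mem_track.2 ⟨k, ha, by simp⟩, a, b, hab, rfl⟩
  · rintro ⟨_, ⟨k, b, hb, rfl⟩, _, hp, a, c, hac, rfl⟩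
    obtain ⟨j, ha, hc⟩ := some_some_mem_track.1 hp
    obtain ⟨rfl, rfl⟩ : j = k ∧ b = c := by grind
    exact ⟨j, a, b, ha, hb, hac⟩

end Palindromes

/-! ### Two-tape behaviors -/

/-- An abstract machine with two one-way heads: `F p q t x` means that it can go from `p` to `q`
while its heads read `t` and `x`. Computations can be composed, and cut at any position of either
head. -/
structure IsTwoTapeBehavior {S γ δ : Type*} (F : S → S → List γ → List δ → Prop) : Prop where
  append {p q r : S} {t t' : List γ} {x x' : List δ} : F p q t x → F q r t' x' →
    F p r (t ++ t') (x ++ x')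
  cut_left {p r : S} {t t' : List γ} {z : List δ} : F p r (t ++ t') z →
    ∃ q x x', z = x ++ x' ∧ F p q t x ∧ F q r t' x'
  cut_right {p r : S} {z : List γ} {x x' : List δ} : F p r z (x ++ x') →
    ∃ q t t', z = t ++ t' ∧ F p q t x ∧ F q r t' x'

namespace IsTwoTapeBehavior

variable {S S' γ δ ε : Type*} {F : S → S → List γ → List δ → Prop}

theorem flip (hF : IsTwoTapeBehavior F) :
    IsTwoTapeBehavior fun p q (x : List δ) (t : List γ) => F p q t x :=
  ⟨hF.append, hF.cut_right, hF.cut_left⟩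

theorem comp {G : S' → S' → List δ → List ε → Prop} (hF : IsTwoTapeBehavior F)
    (hG : IsTwoTapeBehavior G) : IsTwoTapeBehavior fun (p q : S × S') t x =>
      ∃ y, F p.1 q.1 t y ∧ G p.2 q.2 y x where
  append := by
    rintro p q r t t' x x' ⟨y, h₁, h₂⟩ ⟨y', h₁', h₂'⟩
    exact ⟨y ++ y', hF.append h₁ h₁', hG.append h₂ h₂'⟩
  cut_left := by
    rintro p r t t' z ⟨_, h₁, h₂⟩
    obtain ⟨q, y, y', rfl, h, h'⟩ := hF.cut_left h₁
    obtain ⟨q', x, x', rfl, k, k'⟩ := hG.cut_left h₂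
    exact ⟨(q, q'), x, x', rfl, ⟨y, h, k⟩, ⟨y', h', k'⟩⟩
  cut_right := by
    rintro p r z x x' ⟨_, h₁, h₂⟩
    obtain ⟨q', y, y', rfl, k, k'⟩ := hG.cut_right h₂
    obtain ⟨q, t, t', rfl, h, h'⟩ := hF.cut_right h₁
    exact ⟨(q, q'), t, t', rfl, ⟨y, h, k⟩, ⟨y', h', k'⟩⟩

theorem comap_filterMap (hF : IsTwoTapeBehavior F) (f : ε → Option δ) :
    IsTwoTapeBehavior fun p q t (x : List ε) => F p q t (x.filterMap f) where
  append h h' := by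
    rw [List.filterMap_append]
    exact hF.append h h'
  cut_left h := by
    obtain ⟨q, _, _, e, h, h'⟩ := hF.cut_left h
    obtain ⟨x, x', rfl, rfl, rfl⟩ := List.filterMap_eq_append_iff.1 e
    exact ⟨q, x, x', rfl, h, h'⟩
  cut_right h := by
    rw [List.filterMap_append] at h
    exact hF.cut_right h

end IsTwoTapeBehavior

/-- `twoTape N f g p q t x`: some path of `N` from `p` to `q` is labelled by a word from which the
erasing projections `f` and `g` produce `t` and `x`. -/
def twoTape {S Λ γ δ : Type*} (N : NFA Λ S) (f : Λ → Option γ) (g : Λ → Option δ) (p q : S)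
    (t : List γ) (x : List δ) : Prop :=
  ∃ ℓ : List Λ, ℓ.filterMap f = t ∧ ℓ.filterMap g = x ∧ q ∈ N.evalFrom {p} ℓ

theorem mem_evalFrom_append_iff {S Λ : Type*} {N : NFA Λ S} {p r : S} {ℓ ℓ' : List Λ} :
    r ∈ N.evalFrom {p} (ℓ ++ ℓ') ↔ ∃ q ∈ N.evalFrom {p} ℓ, r ∈ N.evalFrom {q} ℓ' := by
  rw [NFA.evalFrom_append, NFA.mem_evalFrom_iff_exists]

theorem mem_evalFrom_singleton_iff {S Λ : Type*} {N : NFA Λ S} {p q : S} {l : Λ} :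
    q ∈ N.evalFrom {p} [l] ↔ q ∈ N.step p l := by
  rw [NFA.evalFrom_singleton, NFA.stepSet_singleton]

theorem filterMap_singleton {Λ γ : Type*} (f : Λ → Option γ) (l : Λ) :
    [l].filterMap f = (f l).toList := by
  cases h : f l <;> simp [h]

theorem twoTape_of_mem_step {S Λ γ δ : Type*} {N : NFA Λ S} {f : Λ → Option γ} {g : Λ → Option δ}
    {p q : S} {l : Λ} (h : q ∈ N.step p l) : twoTape N f g p q (f l).toList (g l).toList :=
  ⟨[l], filterMap_singleton f l, filterMap_singleton g l, mem_evalFrom_singleton_iff.2 h⟩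

theorem isTwoTapeBehavior_twoTape {S Λ γ δ : Type*} (N : NFA Λ S) (f : Λ → Option γ)
    (g : Λ → Option δ) : IsTwoTapeBehavior (twoTape N f g) where
  append := by
    rintro p q r _ _ _ _ ⟨ℓ, rfl, rfl, h⟩ ⟨ℓ', rfl, rfl, h'⟩
    exact ⟨ℓ ++ ℓ', List.filterMap_append, List.filterMap_append,
      mem_evalFrom_append_iff.2 ⟨q, h, h'⟩⟩
  cut_left := by
    rintro p r t t' _ ⟨_, e, rfl, h⟩
    obtain ⟨ℓ, ℓ', rfl, rfl, rfl⟩ := List.filterMap_eq_append_iff.1 e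
    obtain ⟨q, h, h'⟩ := mem_evalFrom_append_iff.1 h
    exact ⟨q, _, _, List.filterMap_append, ⟨ℓ, rfl, rfl, h⟩, ⟨ℓ', rfl, rfl, h'⟩⟩
  cut_right := by
    rintro p r _ x x' ⟨_, rfl, e, h⟩
    obtain ⟨ℓ, ℓ', rfl, rfl, rfl⟩ := List.filterMap_eq_append_iff.1 e
    obtain ⟨q, h, h'⟩ := mem_evalFrom_append_iff.1 h
    exact ⟨q, _, _, List.filterMap_append, ⟨ℓ, rfl, rfl, h⟩, ⟨ℓ', rfl, rfl, h'⟩⟩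

namespace NFATransducer

variable {α β Q : Type}

/-- The automaton over pairs of a symbol that is read and a symbol that is written, either of which
may be absent. Since a transducer may accept before the end of its input, accepting states loop
while the rest of the input is read. -/
def toNFA (M : NFATransducer α β Q) : NFA (Option (TapeSymbol α) × Option β) Q where
  step q l := {p | (q ∉ M.acc ∪ M.rej ∧ (p, l.2) ∈ M.δ q l.1) ∨ (q ∈ M.acc ∧ p = q ∧ l.2 = none)}
  start := {M.start}
  accept := M.acc

variable {M : NFATransducer α β Q}

theorem exists_path_of_emits {q : Q} {t : List (TapeSymbol α)} {y : List β} (h : M.Emits q t y) :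
    ∃ p ∈ M.acc, twoTape M.toNFA Prod.fst Prod.snd q p t y := by
  have hF := isTwoTapeBehavior_twoTape M.toNFA Prod.fst Prod.snd
  induction h with
  | @halt q t hq =>
    refine ⟨q, hq, ?_⟩
    induction t with
    | nil => exact ⟨[], rfl, rfl, rfl⟩
    | cons a t ih =>
      exact hF.append (twoTape_of_mem_step (l := (some a, none)) (.inr ⟨hq, rfl, rfl⟩)) ih
  | @step q p s o t y hq hδ _ ih =>
    obtain ⟨r, hr, h⟩ := ih
    exact ⟨r, hr, hF.append (twoTape_of_mem_step (l := (s, o)) (.inl ⟨hq, hδ⟩)) h⟩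

theorem emits_of_path {q p : Q} {t : List (TapeSymbol α)} {y : List β} (hp : p ∈ M.acc)
    (h : twoTape M.toNFA Prod.fst Prod.snd q p t y) : M.Emits q t y := by
  obtain ⟨ℓ, rfl, rfl, h⟩ := h
  induction ℓ generalizing q with
  | nil => exact .halt _ ((show p = q from h) ▸ hp)
  | cons l ℓ ih =>
    obtain ⟨r, hr, h⟩ := mem_evalFrom_append_iff (ℓ := [l]).1 h
    have hM := ih h
    rw [← List.singleton_append, List.filterMap_append, List.filterMap_append,
      filterMap_singleton, filterMap_singleton]
    rcases mem_evalFrom_singleton_iff.1 hr with ⟨hq, hδ⟩ | ⟨hq, rfl, ho⟩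
    · exact .step hq hδ hM
    · rw [emits_iff_of_mem_acc hq] at hM ⊢
      simp [ho, hM]

theorem mem_function_iff_twoTape {x : List α} {y : List β} : y ∈ M.function x ↔
    ∃ p ∈ M.acc, twoTape M.toNFA Prod.fst Prod.snd M.start p (inputTape x) y :=
  mem_function_iff_emits.trans ⟨exists_path_of_emits, fun ⟨_, hp, h⟩ => emits_of_path hp h⟩

end NFATransducer

theorem exists_twoTape_of_isRegular {α β : Type} {B : Language (Option α × Option β)}
    (hB : B.IsRegular) : ∃ (S : Type) (_ : Finite S) (N : NFA (Option α × Option β) S) (s : S)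
      (A : Set S), ∀ (x : List α) (y : List β), track x y ∈ B ↔
        ∃ r ∈ A, twoTape N Prod.snd Prod.fst s r y x := by
  obtain ⟨S, _, D, hD⟩ := hB.inf (isRegular_setOf_track_eq α β)
  have mem_iff (w : List (Option α × Option β)) :
      (w ∈ B ∧ track (w.filterMap Prod.fst) (w.filterMap Prod.snd) = w) ↔
        ∃ r ∈ D.accept, r ∈ D.toNFA.evalFrom {D.start} w := by
    change w ∈ B ⊓ {w | track (w.filterMap Prod.fst) (w.filterMap Prod.snd) = w} ↔ _
    rw [← hD, ← DFA.toNFA_correct]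
    rfl
  refine ⟨S, inferInstance, D.toNFA, D.start, D.accept, fun x y => ⟨fun h => ?_, ?_⟩⟩
  · obtain ⟨r, hr, hw⟩ := (mem_iff (track x y)).1 ⟨h, by simp⟩
    exact ⟨r, hr, track x y, by simp, by simp, hw⟩
  · rintro ⟨r, hr, w, rfl, rfl, hw⟩
    obtain ⟨hB, e⟩ := (mem_iff w).2 ⟨r, hr, hw⟩
    rwa [e]

theorem exists_isTwoTapeBehavior_of_mem_advice {α : Type} [Finite α] {L : Language α}
    (hL : L ∈ Advice REG NFAMV α) :
    ∃ (S : Type) (_ : Finite S) (F : S → S → List (TapeSymbol α) → List (TapeSymbol α) → Prop)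
      (s : S) (A : Set S), IsTwoTapeBehavior F ∧
        ∀ x, x ∈ L ↔ ∃ r ∈ A, F s r (inputTape x) (inputTape x) := by
  obtain ⟨β, _, B, _, hB, ⟨Q, _, M, -, rfl⟩, hL⟩ := hL
  obtain ⟨S, _, N, s, A, hN⟩ := exists_twoTape_of_isRegular hB
  let f : TapeSymbol α → Option α
    | .letter a => some a
    | _ => none
  have filterMap_inputTape (x : List α) : (inputTape x).filterMap f = x := by
    simp [inputTape, f, List.filterMap_map]
  refine ⟨Q × S, inferInstance, _, (M.start, s), M.acc ×ˢ A,
    (((isTwoTapeBehavior_twoTape M.toNFA Prod.fst Prod.snd).comp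
      (isTwoTapeBehavior_twoTape N Prod.snd Prod.fst)).comap_filterMap f), fun x => ?_⟩
  simp only [filterMap_inputTape, hL, NFATransducer.mem_function_iff_twoTape, hN]
  constructor
  · rintro ⟨y, ⟨p, hp, h⟩, r, hr, h'⟩
    exact ⟨(p, r), ⟨hp, hr⟩, y, h, h'⟩
  · rintro ⟨⟨p, r⟩, ⟨hp, hr⟩, y, h, h'⟩
    exact ⟨y, ⟨p, hp, h⟩, r, hr, h'⟩

theorem exists_ne_of_card_lt {U K : Type*} [Finite K] (hcard : Nat.card K < Nat.card U)
    {L R : U → K → Prop} (h : ∀ u, ∃ k, L u k ∧ R u k) : ∃ u u' k, u ≠ u' ∧ L u k ∧ R u' k := by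
  choose k hL hR using h
  have not_injective : ¬ Function.Injective k := fun hk =>
    hcard.not_ge (Nat.card_le_card_of_injective k hk)
  obtain ⟨u, u', e, hne⟩ := Function.not_injective_iff.1 not_injective
  exact ⟨u, u', k u, hne, hL u, e ▸ hR u'⟩

section Swapping

variable {S γ : Type*} {F : S → S → List γ → List γ → Prop} {s : S} {A : Set S}

/-- Some path of `F` from `s` to `A` on which both heads read `w₁ ++ m ++ w₄` has both heads in
the segment `m` at the same time, at the positions `i` and `j`. -/
def MeetsIn (F : S → S → List γ → List γ → Prop) (s : S) (A : Set S) (w₁ m w₄ : List γ) : Prop :=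
  ∃ q, ∃ i ≤ m.length, ∃ j ≤ m.length, F s q (w₁ ++ m.take i) (w₁ ++ m.take j) ∧
    ∃ r ∈ A, F q r (m.drop i ++ w₄) (m.drop j ++ w₄)

/-- Some path of `F` from `s` to `A` on which both heads read `w₁ ++ w₂ ++ w₃ ++ w₄` has the second
head in `w₁` until the first head has left `w₂ ++ w₃`; the path is recorded by the states in which
the first head leaves `w₂`, the first head leaves `w₃`, and the second head leaves `w₂`, and by the
positions of the other head at these times. -/
def Overtakes (F : S → S → List γ → List γ → Prop) (s : S) (A : Set S) (w₁ w₂ w₃ w₄ : List γ) :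
    Prop :=
  ∃ q₁ q₂ q₃, ∃ i ≤ w₁.length, ∃ j ≤ w₁.length, ∃ k ≤ w₄.length,
    F s q₁ (w₁ ++ w₂) (w₁.take i) ∧ F q₁ q₂ w₃ ((w₁.drop i).take j) ∧
    F q₂ q₃ (w₄.take k) ((w₁.drop i).drop j ++ w₂) ∧ ∃ r ∈ A, F q₃ r (w₄.drop k) (w₃ ++ w₄)

theorem meetsIn_flip_iff {w₁ m w₄ : List γ} :
    MeetsIn (fun p q x t => F p q t x) s A w₁ m w₄ ↔ MeetsIn F s A w₁ m w₄ :=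
  ⟨fun ⟨q, i, hi, j, hj, h⟩ => ⟨q, j, hj, i, hi, h⟩,
    fun ⟨q, i, hi, j, hj, h⟩ => ⟨q, j, hj, i, hi, h⟩⟩

namespace IsTwoTapeBehavior

theorem meetsIn_or_overtakes_of_le (hF : IsTwoTapeBehavior F) {w₁ w₂ w₃ w₄ y y' : List γ}
    {q r : S} (hr : r ∈ A) (h : F s q (w₁ ++ (w₂ ++ w₃)) y) (h' : F q r w₄ y')
    (hyy' : y ++ y' = w₁ ++ ((w₂ ++ w₃) ++ w₄)) (hy : y.length ≤ (w₁ ++ (w₂ ++ w₃)).length) :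
    MeetsIn F s A w₁ (w₂ ++ w₃) w₄ ∨ Overtakes F s A w₁ w₂ w₃ w₄ := by
  rcases List.append_eq_append_iff.1 hyy' with ⟨z, rfl, rfl⟩ | ⟨z, rfl, e⟩
  · right
    rw [← List.append_assoc] at h
    rw [List.append_assoc w₂, ← List.append_assoc z] at h'
    obtain ⟨q₁, x, x', rfl, h₁, h₂⟩ := hF.cut_left h
    obtain ⟨q₃, t, t', rfl, h₃, h₄⟩ := hF.cut_right h'
    exact ⟨q₁, q, q₃, x.length, by simp, x'.length, by simp; omega, t.length, by simp,
      by simpa using h₁, by simpa using h₂, by simpa using h₃, r, hr, by simpa using h₄⟩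
  · left
    obtain ⟨z', hz, rfl⟩ : ∃ z', w₂ ++ w₃ = z ++ z' ∧ y' = z' ++ w₄ := by
      rcases List.append_eq_append_iff.1 e with ⟨z', rfl, rfl⟩ | ⟨z', hz, rfl⟩
      · have : z' = [] := by simpa using hy
        exact ⟨[], by simp [this], by simp [this]⟩
      · exact ⟨z', hz, rfl⟩
    rw [hz] at h ⊢
    exact ⟨q, (z ++ z').length, le_rfl, z.length, by simp, by simpa only [List.take_length,
      List.take_left] using h, r, hr, by simpa using h'⟩

theorem meetsIn_or_overtakes (hF : IsTwoTapeBehavior F) {w₁ w₂ w₃ w₄ : List γ} {r : S}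
    (hr : r ∈ A) (h : F s r (w₁ ++ ((w₂ ++ w₃) ++ w₄)) (w₁ ++ ((w₂ ++ w₃) ++ w₄))) :
    MeetsIn F s A w₁ (w₂ ++ w₃) w₄ ∨ Overtakes F s A w₁ w₂ w₃ w₄ ∨
      Overtakes (fun p q x t => F p q t x) s A w₁ w₂ w₃ w₄ := by
  rw [← List.append_assoc] at h
  obtain ⟨q, y, y', e, h₁, h₂⟩ := hF.cut_left h
  rw [List.append_assoc] at e
  rcases le_total y.length (w₁ ++ (w₂ ++ w₃)).length with hy | hy
  · exact (hF.meetsIn_or_overtakes_of_le hr h₁ h₂ e.symm hy).imp_right .inl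
  · obtain ⟨z, rfl⟩ : w₁ ++ (w₂ ++ w₃) <+: y :=
      List.prefix_of_prefix_length_le ⟨w₄, by rw [List.append_assoc, e]⟩ ⟨y', rfl⟩ hy
    obtain rfl : w₄ = z ++ y' := by simpa using e
    obtain ⟨p, t, t', ht, h₃, h₄⟩ := hF.cut_right h₁
    have h_flip := hF.flip.meetsIn_or_overtakes_of_le hr h₃ (hF.append h₄ h₂)
      (by rw [← List.append_assoc, ← ht, List.append_assoc]) (by simp [ht])
    exact h_flip.imp meetsIn_flip_iff.1 .inr

theorem exists_swap_of_meetsIn [Finite S] {U : Type*} (hF : IsTwoTapeBehavior F)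
    {a d : U → List γ} {m : List γ} {N : ℕ} (hm : m.length ≤ N)
    (hcard : Nat.card S * (N + 1) ^ 2 < Nat.card U) (h : ∀ u, MeetsIn F s A (a u) m (d u)) :
    ∃ u u', u ≠ u' ∧ ∃ r ∈ A, F s r (a u ++ (m ++ d u')) (a u ++ (m ++ d u')) := by
  obtain ⟨u, u', ⟨q, i, j⟩, hne, h₁, r, hr, h₂⟩ := exists_ne_of_card_lt
    (K := S × Fin (N + 1) × Fin (N + 1))
    (L := fun u k => F s k.1 (a u ++ m.take k.2.1) (a u ++ m.take k.2.2))
    (R := fun u k => ∃ r ∈ A, F k.1 r (m.drop k.2.1 ++ d u) (m.drop k.2.2 ++ d u))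
    (by simpa [sq] using hcard) fun u => by
      obtain ⟨q, i, hi, j, hj, h⟩ := h u
      exact ⟨(q, ⟨i, by omega⟩, ⟨j, by omega⟩), h⟩
  exact ⟨u, u', hne, r, hr, by simpa [← List.append_assoc _ (List.drop _ _)] using hF.append h₁ h₂⟩

theorem exists_swap_of_overtakes [Finite S] {I V : Type*} [Finite I]
    {F : I → S → S → List γ → List γ → Prop} (hF : ∀ i, IsTwoTapeBehavior (F i))
    {a d : I → List γ} {b c : V → List γ} {N : ℕ} (ha : ∀ i, (a i).length ≤ N)
    (hd : ∀ i, (d i).length ≤ N)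
    (hcard : Nat.card I * (Nat.card S ^ 3 * (N + 1) ^ 3) < Nat.card V)
    (h : ∀ v, ∃ i, Overtakes (F i) s A (a i) (b v) (c v) (d i)) :
    ∃ i v v', v ≠ v' ∧ ∃ r ∈ A,
      F i s r (a i ++ ((b v ++ c v') ++ d i)) (a i ++ ((b v ++ c v') ++ d i)) := by
  obtain ⟨v, v', ⟨l, ⟨q₁, q₂, q₃⟩, ⟨i, j, k⟩⟩, hne, ⟨h₁, h₃⟩, h₂, r, hr, h₄⟩ :=
    exists_ne_of_card_lt
      (K := I × (S × S × S) × Fin (N + 1) × Fin (N + 1) × Fin (N + 1))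
      (L := fun v ⟨l, ⟨q₁, q₂, q₃⟩, i, j, k⟩ => F l s q₁ (a l ++ b v) ((a l).take i) ∧
        F l q₂ q₃ ((d l).take k) (((a l).drop i).drop j ++ b v))
      (R := fun v ⟨l, ⟨q₁, q₂, q₃⟩, i, j, k⟩ => F l q₁ q₂ (c v) (((a l).drop i).take j) ∧
        ∃ r ∈ A, F l q₃ r ((d l).drop k) (c v ++ d l))
      (by simpa [pow_succ, mul_assoc] using hcard) fun v => by
        obtain ⟨l, q₁, q₂, q₃, i, hi, j, hj, k, hk, h₁, h₂, h₃, h₄⟩ := h v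
        have hal := ha l
        have hdl := hd l
        exact ⟨⟨l, ⟨q₁, q₂, q₃⟩, ⟨i, by omega⟩, ⟨j, by omega⟩, ⟨k, by omega⟩⟩, ⟨h₁, h₃⟩, h₂, h₄⟩
  refine ⟨l, v, v', hne, r, hr, ?_⟩
  have path := (hF l).append h₁ ((hF l).append h₂ ((hF l).append h₃ h₄))
  have reassemble (t : List γ) : (a l).take i ++ (((a l).drop i).take j ++
      (((a l).drop i).drop j ++ t)) = a l ++ t := by
    rw [← List.append_assoc (List.take j _), List.take_append_drop, ← List.append_assoc,
      List.take_append_drop]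
  simpa only [List.append_assoc, reassemble, List.take_append_drop] using path

theorem exists_swap [Finite S] {U V : Type*} [Finite U] (hF : IsTwoTapeBehavior F)
    {a d : U → List γ} {b c : V → List γ} {N : ℕ} (ha : ∀ u, (a u).length ≤ N)
    (hd : ∀ u, (d u).length ≤ N) (hbc : ∀ v, (b v ++ c v).length ≤ N)
    (hU : Nat.card S * (N + 1) ^ 2 < Nat.card U)
    (hV : 2 * Nat.card U * (Nat.card S ^ 3 * (N + 1) ^ 3) < Nat.card V)
    (h : ∀ u v, ∃ r ∈ A,
      F s r (a u ++ ((b v ++ c v) ++ d u)) (a u ++ ((b v ++ c v) ++ d u))) :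
    ∃ u u' v v', (u, v) ≠ (u', v') ∧ ∃ r ∈ A,
      F s r (a u ++ ((b v ++ c v') ++ d u')) (a u ++ ((b v ++ c v') ++ d u')) := by
  by_cases hmeet : ∃ v, ∀ u, MeetsIn F s A (a u) (b v ++ c v) (d u)
  · obtain ⟨v, hv⟩ := hmeet
    obtain ⟨u, u', hne, hr⟩ := hF.exists_swap_of_meetsIn (hbc v) hU hv
    exact ⟨u, u', v, v, by simp [hne], hr⟩
  · push Not at hmeet
    let G : Bool × U → S → S → List γ → List γ → Prop := fun i p q t x =>
      if i.1 then F p q t x else F p q x t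
    have hG : ∀ i, IsTwoTapeBehavior (G i)
      | (true, _) => hF
      | (false, _) => hF.flip
    have hover (v : V) : ∃ i, Overtakes (G i) s A (a i.2) (b v) (c v) (d i.2) := by
      obtain ⟨u, hu⟩ := hmeet v
      obtain ⟨r, hr, hacc⟩ := h u v
      rcases (hF.meetsIn_or_overtakes hr hacc).resolve_left hu with ho | ho
      · exact ⟨(true, u), ho⟩
      · exact ⟨(false, u), ho⟩
    obtain ⟨⟨e, u⟩, v, v', hne, r, hr, hacc⟩ := exists_swap_of_overtakes hG (fun i => ha i.2)
      (fun i => hd i.2) (by simpa using hV) hover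
    exact ⟨u, u, v, v', by simp [hne], r, hr, by cases e <;> exact hacc⟩

end IsTwoTapeBehavior

end Swapping

theorem exists_mul_pow_lt_pow (C d : ℕ) {k : ℕ} (hk : 1 < k) :
    ∃ m, C * (4 * m + 2) ^ d < k ^ m := by
  have tendsto_zero : Filter.Tendsto (fun m : ℕ => (m : ℝ) ^ d / (k : ℝ) ^ m) Filter.atTop
      (nhds 0) := tendsto_pow_const_div_const_pow_of_one_lt d (by exact_mod_cast hk)
  have eventually_lt := tendsto_zero.eventually_lt_const (u := 1 / ((C : ℝ) * 6 ^ d + 1))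
    (by positivity)
  obtain ⟨m, hm, hm₁⟩ := (eventually_lt.and (Filter.eventually_ge_atTop 1)).exists
  refine ⟨m, ?_⟩
  have hkm : (0 : ℝ) < (k : ℝ) ^ m := by positivity
  rw [div_lt_div_iff₀ hkm (by positivity), one_mul] at hm
  have hm' : m ^ d * (C * 6 ^ d + 1) < k ^ m := by exact_mod_cast hm
  calc C * (4 * m + 2) ^ d ≤ C * (6 * m) ^ d := by gcongr; omega
    _ = m ^ d * (C * 6 ^ d) := by rw [mul_pow]; ring
    _ ≤ m ^ d * (C * 6 ^ d + 1) := by gcongr; omega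
    _ < k ^ m := hm'

theorem eq_of_palindrome_append {α : Type*} {u v u' v' : List α} (hu : u.length = u'.length)
    (hv : v.length = v'.length) (h : (u ++ ((v ++ v'.reverse) ++ u'.reverse)).Palindrome) :
    u = u' ∧ v = v' := by
  have e : u' ++ (v' ++ (v.reverse ++ u.reverse)) = u ++ (v ++ (v'.reverse ++ u'.reverse)) := by
    simpa using h.reverse_eq
  obtain ⟨hu', e⟩ := List.append_inj e hu.symm
  exact ⟨hu'.symm, (List.append_inj e hv.symm).1.symm⟩

theorem natCard_vector (α : Type*) [Finite α] (n : ℕ) :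
    Nat.card (List.Vector α n) = Nat.card α ^ n := by
  have := Fintype.ofFinite α
  simp

theorem inputTape_append {α : Type} (u v v' u' : List α) : inputTape (u ++ ((v ++ v') ++ u')) =
    (.leftEnd :: u.map .letter) ++ ((v.map .letter ++ v'.map .letter) ++
      (u'.map .letter ++ [.rightEnd])) := by
  simp [inputTape]

theorem palindromes_not_mem_advice {α : Type} [Finite α] [Nontrivial α] :
    palindromes α ∉ Advice REG NFAMV α := by
  intro h
  obtain ⟨S, _, F, s, A, hF, hL⟩ := exists_isTwoTapeBehavior_of_mem_advice h
  obtain ⟨m, hm⟩ := exists_mul_pow_lt_pow (2 * Nat.card S ^ 3) 3 (Finite.one_lt_card (α := α))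
  have hU : Nat.card S * (4 * m + 1 + 1) ^ 2 < Nat.card (List.Vector α m) := by
    rw [natCard_vector]
    refine lt_of_le_of_lt (Nat.mul_le_mul ?_ ?_) hm
    · exact (Nat.le_self_pow three_ne_zero _).trans (Nat.le_mul_of_pos_left _ two_pos)
    · exact Nat.pow_le_pow_right (by omega) (by norm_num)
  have hV : 2 * Nat.card (List.Vector α m) * (Nat.card S ^ 3 * (4 * m + 1 + 1) ^ 3) <
      Nat.card (List.Vector α (2 * m)) := by
    rw [natCard_vector, natCard_vector, two_mul m, pow_add]
    calc 2 * Nat.card α ^ m * (Nat.card S ^ 3 * (4 * m + 1 + 1) ^ 3)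
        = Nat.card α ^ m * (2 * Nat.card S ^ 3 * (4 * m + 2) ^ 3) := by ring
      _ < Nat.card α ^ m * Nat.card α ^ m := mul_lt_mul_of_pos_left hm (pow_pos Nat.card_pos m)
  obtain ⟨u, u', v, v', hne, hacc⟩ := hF.exists_swap (s := s) (A := A) (N := 4 * m + 1)
    (U := List.Vector α m) (V := List.Vector α (2 * m))
    (a := fun u => .leftEnd :: u.toList.map .letter)
    (b := fun v => v.toList.map .letter) (c := fun v => v.toList.reverse.map .letter)
    (d := fun u => u.toList.reverse.map .letter ++ [.rightEnd])
    (by simp; omega) (by simp; omega) (by simp; omega) hU hV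
    (fun u v => by
      rw [← inputTape_append, ← hL]
      exact List.Palindrome.of_reverse_eq (by simp))
  rw [← inputTape_append, ← hL] at hacc
  obtain ⟨hu, hv⟩ := eq_of_palindrome_append (by simp) (by simp) hacc
  exact hne (Prod.ext (Subtype.ext hu) (Subtype.ext hv))

theorem not_CFL_contained_advice_NFAMV : ¬ CFL.Contained (Advice REG NFAMV) := fun h =>
  palindromes_not_mem_advice (h Bool isContextFree_palindromes)

theorem not_closedUnderCompl_advice_NFAMV : ¬ (Advice REG NFAMV).ClosedUnderCompl := fun h =>
  palindromes_not_mem_advice (α := Bool)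
    (compl_compl (palindromes Bool) ▸ h Bool _ compl_palindromes_mem_advice)

theorem mainTheorem6 :
    (¬ (Advice REG NFASVt).Contained CFL ∧ ¬ CFL.Contained (Advice REG NFAMV)) ∧
    ((Advice REG NFASVt).ClosedUnderCompl ∧ ¬ (Advice REG NFAMV).ClosedUnderCompl) ∧
    (CFL.inter CFL.co).ProperlyContained (Advice REG CFLSVt) := by
  exact ⟨⟨not_advice_NFASVt_contained_CFL, not_CFL_contained_advice_NFAMV⟩,
    ⟨closedUnderCompl_advice_NFASVt, not_closedUnderCompl_advice_NFAMV⟩,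
    inter_co_contained_advice_CFLSVt, not_advice_CFLSVt_contained_inter⟩
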